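/- A radio labelling of a finite connected graph $G$ is a map $f : V(G) \to \{0,1,2,\ldots\}$ with $|f(u)-f(v)| \ge \mathrm{diam}(G)+1-d(u,v)$ for all distinct vertices $u,v$; its span is $\max_{u,v}|f(u)-f(v)|$, and the radio number $\mathrm{rn}(G)$ is the minimum span of a radio labelling of $G$. For a finite tree $T$ with center $L_0$ (the set of vertices of minimum eccentricity, which has one or two elements), the level of a vertex is its distance to $L_0$, and the height of $T$ is $\lfloor \mathrm{diam}(T)/2\rfloor$. For $z \in \{1,2\}$ and $h \ge 1$, let $T^z_{m_0,m_1,\ldots,m_{h-1}}$ denote the tree (unique up to isomorphism) of height $h$ with $|L_0| = z$ in which every vertex at level $i$ has degree $m_i$, for $0 \le i \le h-1$ (so that the vertices at level $h$ are the leaves). Theorem. Let $h \ge 1$, let $m_i \ge 3$ be integers for $1 \le i \le h-1$, and set $T^z = T^z_{2,m_1,\ldots,m_{h-1}}$ for $z = 1,2$. Then, if $h \ge 2$, $$\mathrm{rn}(T^1) = \sum_{i=1}^{h-1}\bigl(4(h-i)-2\bigr)\prod_{j=1}^{i}(m_j-1) + \prod_{i=1}^{h-1}(m_i-1) + 4h-1,$$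 and, for every $h \ge 1$, $$\mathrm{rn}(T^2) = \sum_{i=1}^{h-1}\bigl(4(h-i)-2\bigr)\prod_{j=1}^{i}(m_j-1) + 2\prod_{i=1}^{h-1}(m_i-1) + 6h-3.$$ (Empty sums are $0$ and empty products are $1$.) -/

import Mathlib

namespace RadioLabelling

variable {V : Type*}

/-- A radio labelling of `G`: a map `f : V → {0, 1, 2, …}` such that
`|f u - f v| ≥ diam G + 1 - d(u, v)` for all distinct vertices `u`, `v`. -/
def IsRadioLabelling (G : SimpleGraph V) (f : V → ℕ) : Prop :=
  ∀ u v : V, u ≠ v → (G.diam : ℤ) + 1 - (G.dist u v : ℤ) ≤ |(f u : ℤ) - (f v : ℤ)|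

/-- The span of a labelling: the maximum of `|f u - f v|` over all vertices `u`, `v`. -/
def span [Fintype V] (f : V → ℕ) : ℕ :=
  Finset.univ.sup fun p : V × V => ((f p.1 : ℤ) - (f p.2 : ℤ)).natAbs

/-- The radio number of a finite graph: the minimum span of a radio labelling. -/
noncomputable def radioNumber [Fintype V] (G : SimpleGraph V) : ℕ :=
  sInf {k : ℕ | ∃ f : V → ℕ, IsRadioLabelling G f ∧ span f = k}

/-- The minimum in the definition of the radio number is attained. -/
theorem radioNumber_isLeast [Fintype V] (G : SimpleGraph V) :
    IsLeast {k : ℕ | ∃ f : V → ℕ, IsRadioLabelling G f ∧ span f = k} (radioNumber G) := by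
  have hne : {k : ℕ | ∃ f : V → ℕ, IsRadioLabelling G f ∧ span f = k}.Nonempty := by
    let e := Fintype.equivFin V
    refine ⟨_, fun v => (G.diam + 1) * (e v : ℕ), ?_, rfl⟩
    intro u v huv
    have h1 : ((e u : ℕ) : ℤ) - ((e v : ℕ) : ℤ) ≠ 0 := by
      intro h
      apply huv
      apply e.injective
      apply Fin.ext
      omega
    have h2 : (1 : ℤ) ≤ |((e u : ℕ) : ℤ) - ((e v : ℕ) : ℤ)| := Int.one_le_abs h1
    push_cast
    rw [← mul_sub, abs_mul, abs_of_nonneg (by positivity : (0 : ℤ) ≤ (G.diam : ℤ) + 1)]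
    have h3 : (0 : ℤ) ≤ G.diam := by positivity
    have h4 : (0 : ℤ) ≤ G.dist u v := by positivity
    nlinarith
  exact ⟨Nat.sInf_mem hne, fun k hk => Nat.sInf_le hk⟩

/-- The level of a vertex: its distance `min {d(v, c) : c ∈ L₀}` to the center `L₀` of `G`, the set
of the vertices of minimum eccentricity. -/
noncomputable def level (G : SimpleGraph V) (v : V) : ℕ :=
  sInf ((fun c => G.dist v c) '' G.center)

/-- `G` is (isomorphic to) the level-wise regular tree `T^z_{m 0, m 1, …, m (h - 1)}`: a tree of
height `h = ⌊diam G / 2⌋` whose center consists of `z` vertices, in which every vertex at a level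
`i ≤ h - 1` has degree `m i`. (The remaining vertices, those at level `h`, are automatically leaves;
the values `m i` with `i ≥ h` are irrelevant.) -/
structure IsLevelwiseRegularTree [Fintype V] (G : SimpleGraph V) (z h : ℕ) (m : ℕ → ℕ) :
    Prop where
  isTree : G.IsTree
  height_eq : G.diam / 2 = h
  center_ncard : G.center.ncard = z
  degree_eq : ∀ v : V, level G v < h → (G.neighborSet v).ncard = m (level G v)

end RadioLabelling

/-! ### Distances and central vertices in a tree. -/

namespace RadioLabelling

variable {V : Type*}

/-! Since `m 0 = 2`, the tree splits at its center into two halves, each with a single vertex at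
level 1 and `P k = ∏_{j ≤ k} (m j - 1)` vertices at level `k + 1`. The diameter is `2h + z - 1`, and
`d(u, v) ≤ lev u + lev v + z - 1`. So if the vertices are listed as `x 0, x 1, …` by increasing
label, each gap exceeds `2h + 1 - lev (x i) - lev (x (i + 1))` by some `e i ≥ 0`. Telescoping, the
gap from first to last label is `∑ v, (2h + 1 - 2 lev v) - (2h + 1)` plus the two end levels plus `∑
e i`. Only the end levels and the excesses depend on the order.

Lower bound (`Coord.le_span`): among three consecutive noncentral vertices two share a half, and
their paths to the center overlap. If the middle one is a leaf, this forces `e i + e (i + 1) ≥ z`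
(`Coord.le_excess`). Each gap belongs to at most two such triples, so about half of `z` times the
number `2 P (h - 1)` of leaves is unavoidable; the rest is bookkeeping at the ends and around the
central vertices.

Upper bound (`Coord.exists_labelling`): alternate between the halves and keep vertices with long
common paths far apart. Numbering each half in mixed radix, so that the ancestors of a vertex are
residues of its number, makes vertices sharing `j` edges differ by a multiple of `P (j - 1) ≥ 2 ^ (j
- 1)` in rank. Such an overlap is logarithmic in the distance in the list, while the labels grow at
least linearly. Only vertices two or four places apart need extra excess, and one gap with excess
`z` serves the leaf on each side of it. -/

theorem dist_closer_unique {G : SimpleGraph V} (hG : G.IsTree) {x v a b : V}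
    (ha : G.Adj v a) (hb : G.Adj v b) (hda : G.dist x v = G.dist x a + 1)
    (hdb : G.dist x v = G.dist x b + 1) : a = b := by
  have key : ∀ c, G.Adj v c → G.dist x v = G.dist x c + 1 →
      ∃ q : G.Walk x v, q.IsPath ∧ q.penultimate = c := by
    classical
    intro c hc hd
    obtain ⟨q, hq, hl⟩ := (hG.connected x c).exists_path_of_dist
    refine ⟨q.concat hc.symm, hq.concat ?_ hc.symm, by simp⟩
    intro hv
    have h1 := SimpleGraph.dist_le (q.takeUntil v hv)
    have h2 := q.length_takeUntil_le_length hv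
    omega
  obtain ⟨p, hp, rfl⟩ := key a ha hda
  obtain ⟨q, hq, rfl⟩ := key b hb hdb
  rw [(hG.existsUnique_path x v).unique hp hq]

theorem exists_adj_closer {G : SimpleGraph V} (hG : G.Connected) {x v : V} (h : G.dist x v ≠ 0) :
    ∃ a, G.Adj v a ∧ G.dist x v = G.dist x a + 1 := by
  obtain ⟨p, hp⟩ := hG.exists_walk_length_eq_dist v x
  rw [SimpleGraph.dist_comm] at hp
  cases p with
  | nil => simp at h
  | @cons _ a _ hadj q =>
    refine ⟨a, hadj, ?_⟩
    have h1 := SimpleGraph.dist_le q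
    rw [SimpleGraph.dist_comm] at h1
    have h2 := hG.dist_triangle (u := x) (v := a) (w := v)
    rw [SimpleGraph.dist_eq_one_iff_adj.2 hadj.symm] at h2
    simp at hp
    omega

/-- A geodesic towards `c` that has once stepped away from `y` can never turn back: the only
neighbour closer to `y` is the vertex just left. -/
theorem dist_eq_add_of_away {G : SimpleGraph V} (hG : G.IsTree) (y c : V) (n : ℕ) :
    ∀ a b, G.Adj a b → G.dist y b = G.dist y a + 1 → G.dist c a = n + 1 → G.dist c b = n →
      G.dist y c = G.dist y b + n := by
  induction n with
  | zero =>
    intro a b _ _ _ hb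
    rw [(hG.connected.dist_eq_zero_iff).1 hb]
    rfl
  | succ n ih =>
    intro a b hab hy ha hb
    obtain ⟨x, hx, hd⟩ := exists_adj_closer hG.connected (x := c) (v := b) (by omega)
    have hyx : G.dist y x = G.dist y b + 1 := by
      rcases hG.dist_eq_dist_add_one_of_adj y hx with h | h
      · have := dist_closer_unique hG hx hab.symm h hy
        subst this
        omega
      · exact h
    have := ih b x hx hyx hb (by omega)
    omega

theorem sub_le_dist {G : SimpleGraph V} (hG : G.Connected) (F : V → ℤ)
    (hF : ∀ u v, G.Adj u v → F v ≤ F u + 1) (x y : V) : F y - F x ≤ G.dist x y := by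
  obtain ⟨p, hp⟩ := hG.exists_walk_length_eq_dist x y
  rw [← hp]
  clear hp
  induction p with
  | nil => simp
  | cons h q ih =>
    have := hF _ _ h
    simp only [SimpleGraph.Walk.length_cons]
    push_cast
    omega

/-- Minimality of the eccentricity in terms of natural-number distances, so that later arguments
avoid `ℕ∞`. -/
theorem mem_center_iff_forall_dist [Finite V] {G : SimpleGraph V} (hG : G.Connected) (u : V) :
    u ∈ G.center ↔ ∀ (w : V) (k : ℕ), (∀ v, G.dist w v ≤ k) → ∀ v, G.dist u v ≤ k := by
  have key : ∀ (w : V) (k : ℕ), G.eccent w ≤ k ↔ ∀ v, G.dist w v ≤ k := by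
    intro w k
    rw [SimpleGraph.eccent_le_iff]
    refine forall_congr' fun v => ?_
    rw [← (hG w v).coe_dist_eq_edist]
    exact_mod_cast Iff.rfl
  rw [SimpleGraph.mem_center_iff]
  constructor
  · intro h w k hw
    rw [← key] at hw ⊢
    rw [h]
    exact SimpleGraph.radius_le_eccent.trans hw
  · intro h
    have := hG.nonempty
    refine le_antisymm ?_ SimpleGraph.radius_le_eccent
    obtain ⟨w, hw⟩ := G.exists_eccent_eq_radius
    rw [← hw]
    have hne : G.eccent w ≠ ⊤ := by
      rw [hw]; exact SimpleGraph.radius_ne_top_iff.2 hG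
    rw [← ENat.natCast_toNat hne, key]
    apply h w
    rw [← key, ENat.natCast_toNat hne]

/-- If `c` and `d` were not adjacent, the neighbour `x` of `c` towards `d` would have smaller
eccentricity: a vertex is either closer to `x` than to `c`, or strictly farther from `d` than from
`x`. -/
theorem center_adj [Finite V] {G : SimpleGraph V} (hG : G.IsTree) {c d : V}
    (hc : c ∈ G.center) (hd : d ∈ G.center) (hne : c ≠ d) : G.Adj c d := by
  have := hG.connected.nonempty
  rw [mem_center_iff_forall_dist hG.connected] at hc hd
  obtain ⟨v0, hv0⟩ := Finite.exists_max (fun v => G.dist c v)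
  have hd' := hd c _ hv0
  have hpos := hG.connected.pos_dist_of_ne hne
  rw [SimpleGraph.dist_comm] at hpos
  obtain ⟨x, hx, hxd⟩ := exists_adj_closer hG.connected hpos.ne'
  by_cases hxe : x = d
  · exact hxe ▸ hx
  exfalso
  have hxpos := hG.connected.pos_dist_of_ne hxe
  have hle : ∀ y, G.dist x y ≤ G.dist c v0 - 1 := by
    intro y
    rcases hG.dist_eq_dist_add_one_of_adj y hx with h | h
    · have := hv0 y
      simp only [SimpleGraph.dist_comm (u := y)] at h
      omega
    · have h1 := dist_eq_add_of_away hG y d (G.dist d x) c x hx h hxd rfl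
      have := hd' y
      simp only [SimpleGraph.dist_comm (u := y), SimpleGraph.dist_comm (u := x) (v := d)] at *
      omega
  have := hc x _ hle v0
  have := hv0 d
  rw [SimpleGraph.dist_comm] at this
  omega

/-! ### Rooted trees split into two halves. -/

/-- A tree rooted at its center, which consists of `z ≤ 2` vertices, and split into two halves:
`lev v` is the distance to the center, `par v` the parent of `v`, and `side v` tells the half. -/
structure Halves (G : SimpleGraph V) (z : ℕ) (lev : V → ℕ) (par : V → V) (side : V → Bool) :
    Prop where
  connected : G.Connected
  z_eq : z = 1 ∨ z = 2
  adj_par : ∀ v, lev v ≠ 0 → G.Adj v (par v)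
  lev_par : ∀ v, lev v ≠ 0 → lev (par v) + 1 = lev v
  adj_cases : ∀ u v, G.Adj u v → (lev v ≠ 0 ∧ u = par v) ∨ (lev u ≠ 0 ∧ v = par u) ∨
    (z = 2 ∧ lev u = 0 ∧ lev v = 0 ∧ side u ≠ side v)
  side_par : ∀ v, lev v ≠ 0 → (lev v = 1 ∧ z = 1) ∨ side (par v) = side v
  one_unique : ∀ u v, lev u = 1 → lev v = 1 → side u = side v → u = v
  one_exists : ∀ s, ∃ v, lev v = 1 ∧ side v = s
  zero_unique : ∀ u v, lev u = 0 → lev v = 0 → (z = 2 → side u = side v) → u = v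
  zero_exists : ∀ s, ∃ v, lev v = 0 ∧ (z = 2 → side v = s)
  zero_dist : ∀ u v, lev u = 0 → lev v = 0 → G.dist u v ≤ z - 1

namespace Halves

variable {G : SimpleGraph V} {z : ℕ} {lev : V → ℕ} {par : V → V} {side : V → Bool}

theorem exists_center (H : Halves G z lev par side) (v : V) :
    ∃ c, lev c = 0 ∧ G.dist v c ≤ lev v := by
  induction hk : lev v generalizing v with
  | zero => exact ⟨v, hk, by simp⟩
  | succ k ih =>
    have hv : lev v ≠ 0 := by omega
    have h1 := H.lev_par v hv
    obtain ⟨c, hc, hd⟩ := ih (par v) (by omega)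
    have h2 := H.connected.dist_triangle (u := v) (v := par v) (w := c)
    rw [SimpleGraph.dist_eq_one_iff_adj.2 (H.adj_par v hv)] at h2
    exact ⟨c, hc, by omega⟩

theorem dist_le (H : Halves G z lev par side) (u v : V) :
    G.dist u v ≤ lev u + lev v + (z - 1) := by
  obtain ⟨c, hc, hu⟩ := H.exists_center u
  obtain ⟨d, hd, hv⟩ := H.exists_center v
  have h1 := H.connected.dist_triangle (u := u) (v := c) (w := v)
  have h2 := H.connected.dist_triangle (u := c) (v := d) (w := v)
  have h3 := H.zero_dist c d hc hd
  rw [SimpleGraph.dist_comm] at hv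
  omega

theorem exists_top (H : Halves G z lev par side) (v : V) (hv : lev v ≠ 0) :
    ∃ a, lev a = 1 ∧ side a = side v ∧ G.dist v a + 1 ≤ lev v := by
  obtain ⟨k, hk⟩ := Nat.exists_eq_succ_of_ne_zero hv
  induction k generalizing v with
  | zero => exact ⟨v, hk, rfl, by simp [hk]⟩
  | succ k ih =>
    have h1 := H.lev_par v hv
    obtain ⟨a, ha, hs, hd⟩ := ih (par v) (by omega) (by omega)
    have h2 := H.connected.dist_triangle (u := v) (v := par v) (w := a)
    rw [SimpleGraph.dist_eq_one_iff_adj.2 (H.adj_par v hv)] at h2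
    refine ⟨a, ha, ?_, by omega⟩
    rcases H.side_par v hv with h | h
    · omega
    · rw [hs, h]

theorem dist_le_of_side_eq (H : Halves G z lev par side) {u v : V} (hu : lev u ≠ 0)
    (hv : lev v ≠ 0) (h : side u = side v) : G.dist u v + 2 ≤ lev u + lev v := by
  obtain ⟨a, ha, hsa, hda⟩ := H.exists_top u hu
  obtain ⟨b, hb, hsb, hdb⟩ := H.exists_top v hv
  obtain rfl := H.one_unique a b ha hb (by rw [hsa, hsb, h])
  have h1 := H.connected.dist_triangle (u := u) (v := a) (w := v)
  rw [SimpleGraph.dist_comm] at hdb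
  omega

/-- A potential on the vertices that changes by at most one along each edge bounds distances. -/
theorem sub_le_dist (H : Halves G z lev par side) (F : V → ℤ)
    (hpar : ∀ v, lev v ≠ 0 → |F v - F (par v)| ≤ 1)
    (hzero : ∀ u v, z = 2 → lev u = 0 → lev v = 0 → side u ≠ side v → F v ≤ F u + 1) (x y : V) :
    F y - F x ≤ G.dist x y := by
  refine RadioLabelling.sub_le_dist H.connected F (fun u v huv => ?_) x y
  rcases H.adj_cases u v huv with ⟨h, rfl⟩ | ⟨h, rfl⟩ | ⟨h1, h2, h3, h4⟩
  · have := abs_le.1 (hpar v h); omega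
  · have := abs_le.1 (hpar u h); omega
  · exact hzero u v h1 h2 h3 h4

theorem le_dist_of_side_ne (H : Halves G z lev par side) {x y : V}
    (hy : lev y ≠ 0) (h : side x ≠ side y) :
    lev x + lev y + (z - 1) ≤ G.dist x y := by
  have hz := H.z_eq
  -- The potential is the signed progress from `x` through the center into the other half; for `z =
  -- 1` the single central vertex, whose `side` is meaningless, is put in the branch of `x`.
  have key := H.sub_le_dist
    (fun v => if side v = side x ∨ (z = 1 ∧ lev v = 0) then (lev x : ℤ) - lev v
      else lev x + lev v + (z - 1)) ?_ ?_ x y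
  · simp only [true_or, if_true] at key
    rw [if_neg (by simp [hy, Ne.symm h])] at key
    omega
  · intro v hv
    have h1 := H.lev_par v hv
    rcases H.side_par v hv with ⟨h2, h3⟩ | h2
    · have h4 : lev (par v) = 0 := by omega
      simp only [h3, h4, h2, and_self, or_true, if_true, one_ne_zero, and_false, or_false]
      split_ifs <;> simp
    · rw [h2, abs_le]
      split_ifs with h3 h4 h4
      · omega
      · have h5 : side v ≠ side x := fun h => h4 (Or.inl h)
        rcases h3 with h3 | h3
        · exact absurd h3 h5
        · omega
      · have h5 : side v ≠ side x := fun h => h3 (Or.inl h)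
        rcases h4 with h4 | h4
        · exact absurd h4 h5
        · rw [h4.1]; push_cast; omega
      · omega
  · rintro u v hz2 hu hv huv
    rw [hu, hv, hz2]
    split_ifs <;> push_cast <;> omega

end Halves

/-! ### Mixed-radix coordinates, overlaps and level counts. -/

/-- A `Halves` structure of height `h` in which the `P k` vertices at level `k + 1` of each half
are numbered in such a way that the number of the parent of `v` at level `k + 1` is the residue
modulo `P k` of the number of `v`. -/
structure Coord (G : SimpleGraph V) (z h : ℕ) (P : ℕ → ℕ) (lev : V → ℕ) (par : V → V)
    (side : V → Bool) (code : V → ℕ) : Prop extends Halves G z lev par side where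
  h_pos : 1 ≤ h
  P_zero : P 0 = 1
  P_succ : ∀ i, i + 1 < h → ∃ b, 2 ≤ b ∧ P (i + 1) = P i * b
  lev_le : ∀ v, lev v ≤ h
  code_lt : ∀ v, lev v ≠ 0 → code v < P (lev v - 1)
  code_par : ∀ v, 2 ≤ lev v → code (par v) = code v % P (lev v - 2)
  code_inj : ∀ u v, lev u ≠ 0 → lev u = lev v → side u = side v → code u = code v → u = v
  code_surj : ∀ s k t, k < h → t < P k → ∃ v, lev v = k + 1 ∧ side v = s ∧ code v = t

/-- The number of edges shared by the paths to `u` and to `v` in a half. -/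
def overlap (P : ℕ → ℕ) (lev : V → ℕ) (side : V → Bool) (code : V → ℕ) (u v : V) : ℕ :=
  ((Finset.Icc 1 (min (lev u) (lev v))).filter
    fun j => side u = side v ∧ code u % P (j - 1) = code v % P (j - 1)).card

theorem card_filter_Icc_step (Q : ℕ → Prop) [DecidablePred Q] {a b : ℕ} (h1 : a ≤ b)
    (h2 : b ≤ a + 1) : ((Finset.Icc 1 a).filter Q).card ≤ ((Finset.Icc 1 b).filter Q).card ∧
      ((Finset.Icc 1 b).filter Q).card ≤ ((Finset.Icc 1 a).filter Q).card + 1 := by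
  constructor
  · exact Finset.card_le_card (Finset.filter_subset_filter _ (Finset.Icc_subset_Icc_right h1))
  · refine (Finset.card_le_card (t := insert (a + 1) ((Finset.Icc 1 a).filter Q)) ?_).trans
      (Finset.card_insert_le _ _)
    intro j hj
    simp only [Finset.mem_filter, Finset.mem_Icc, Finset.mem_insert] at hj ⊢
    by_cases h : j = a + 1
    · exact Or.inl h
    · exact Or.inr ⟨⟨hj.1.1, by omega⟩, hj.2⟩

namespace Coord

variable {G : SimpleGraph V} {z h : ℕ} {P : ℕ → ℕ} {lev : V → ℕ} {par : V → V} {side : V → Bool}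
  {code : V → ℕ}

theorem P_dvd (C : Coord G z h P lev par side code) {i j : ℕ} (hij : i ≤ j) (hj : j < h) :
    P i ∣ P j := by
  induction j, hij using Nat.le_induction with
  | base => rfl
  | succ j hij ih =>
    obtain ⟨b, _, hb⟩ := C.P_succ j hj
    exact (ih (by omega)).trans ⟨b, hb⟩

theorem two_pow_le_P (C : Coord G z h P lev par side code) {i : ℕ} (hi : i < h) :
    2 ^ i ≤ P i := by
  induction i with
  | zero => simp [C.P_zero]
  | succ i ih =>
    obtain ⟨b, hb, hP⟩ := C.P_succ i hi
    rw [hP, pow_succ]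
    exact Nat.mul_le_mul (ih (by omega)) hb

theorem P_pos (C : Coord G z h P lev par side code) {i : ℕ} (hi : i < h) : 0 < P i :=
  (Nat.two_pow_pos i).trans_le (C.two_pow_le_P hi)

theorem overlap_self (u : V) : overlap P lev side code u u = lev u := by
  simp [overlap]

theorem overlap_of_side_ne {u v : V} (hs : side u ≠ side v) :
    overlap P lev side code u v = 0 := by
  simp [overlap, hs]

theorem overlap_of_lev_eq_zero {u v : V} (hs : lev u = 0 ∨ lev v = 0) :
    overlap P lev side code u v = 0 := by
  rcases hs with hs | hs <;> simp [overlap, hs]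

/-- Passing to the parent preserves all the residues that are still compared, since these moduli
divide the one that defines the parent's code. Only the comparison at the level of `v` can
disappear. -/
theorem overlap_par (C : Coord G z h P lev par side code) (u v : V) (hv : lev v ≠ 0)
    (hs : side (par v) = side v) :
    overlap P lev side code u (par v) ≤ overlap P lev side code u v ∧
      overlap P lev side code u v ≤ overlap P lev side code u (par v) + 1 := by
  have h1 := C.lev_par v hv
  have h2 : overlap P lev side code u (par v) =
      ((Finset.Icc 1 (min (lev u) (lev (par v)))).filter
        fun j => side u = side v ∧ code u % P (j - 1) = code v % P (j - 1)).card := by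
    unfold overlap
    congr 1
    apply Finset.filter_congr
    intro j hj
    rw [Finset.mem_Icc] at hj
    have h3 : P (j - 1) ∣ P (lev v - 2) := by
      refine C.P_dvd (by omega) ?_
      have := C.lev_le v
      omega
    rw [hs, C.code_par v (by omega), Nat.mod_mod_of_dvd _ h3]
  rw [h2]
  exact card_filter_Icc_step _ (by omega) (by omega)

/-- The left side, as a function of `v`, is 1-Lipschitz: along an edge to a parent the level drops
by one and the overlap by zero or one, so `lev - 2 * overlap` changes by exactly one. It vanishes at
`v = u` up to sign conventions, being `lev u + lev u - 2 * lev u`. -/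
theorem le_dist (C : Coord G z h P lev par side code) (u v : V) :
    (lev u : ℤ) + lev v + (if side u = side v then 0 else (z : ℤ) - 1)
      - 2 * overlap P lev side code u v ≤ G.dist u v := by
  have key := C.sub_le_dist
    (fun v => (lev u : ℤ) + lev v + (if side u = side v then 0 else (z : ℤ) - 1)
      - 2 * overlap P lev side code u v) ?_ ?_ u v
  · simp only [overlap_self, if_true] at key
    linarith
  · intro v hv
    have h1 := C.lev_par v hv
    rcases C.side_par v hv with ⟨h2, h3⟩ | h2
    · have h4 : lev (par v) = 0 := by omega
      have h5 : overlap P lev side code u v ≤ 1 := by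
        refine (Finset.card_filter_le _ _).trans ?_
        simp [h2]
      simp only [overlap_of_lev_eq_zero (u := u) (Or.inr h4), h3, h4, h2, abs_le]
      split_ifs <;> push_cast <;> omega
    · have h3 := C.overlap_par u v hv h2
      simp only [h2, abs_le]
      split_ifs <;> omega
  · intro a b hz ha hb hab
    simp only [overlap_of_lev_eq_zero (u := u) (Or.inr ha),
      overlap_of_lev_eq_zero (u := u) (Or.inr hb), hz, ha, hb]
    split_ifs <;> push_cast <;> omega

variable [Fintype V]

theorem card_lev_zero (C : Coord G z h P lev par side code) :
    (Finset.univ.filter fun v => lev v = 0).card = z := by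
  rcases C.z_eq with rfl | rfl
  · obtain ⟨c, hc, -⟩ := C.zero_exists true
    rw [Finset.card_eq_one]
    refine ⟨c, ?_⟩
    ext v
    simp only [Finset.mem_filter, Finset.mem_univ, true_and, Finset.mem_singleton]
    exact ⟨fun hv => C.zero_unique v c hv hc (by simp), fun hv => hv ▸ hc⟩
  · classical
    obtain ⟨c, hc, hcs⟩ := C.zero_exists true
    obtain ⟨d, hd, hds⟩ := C.zero_exists false
    rw [Finset.card_eq_two]
    refine ⟨c, d, fun h => by simp [h, hds rfl] at hcs, ?_⟩
    ext v
    simp only [Finset.mem_filter, Finset.mem_univ, true_and, Finset.mem_insert,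
      Finset.mem_singleton]
    constructor
    · intro hv
      cases hs : side v
      · exact Or.inr (C.zero_unique v d hv hd (by simp [hs, hds]))
      · exact Or.inl (C.zero_unique v c hv hc (by simp [hs, hcs]))
    · rintro (rfl | rfl) <;> assumption

theorem card_lev_succ (C : Coord G z h P lev par side code) {k : ℕ} (hk : k < h) :
    (Finset.univ.filter fun v => lev v = k + 1).card = 2 * P k := by
  have : (Finset.univ.filter fun v => lev v = k + 1).card =
      ((Finset.univ : Finset Bool) ×ˢ Finset.range (P k)).card := by
    refine Finset.card_bij (fun v _ => (side v, code v)) ?_ ?_ ?_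
    · intro v hv
      simp only [Finset.mem_filter, Finset.mem_univ, true_and] at hv
      have := C.code_lt v (by omega)
      simpa [hv] using this
    · intro u hu v hv huv
      simp only [Finset.mem_filter, Finset.mem_univ, true_and] at hu hv
      simp only [Prod.mk.injEq] at huv
      exact C.code_inj u v (by omega) (by omega) huv.1 huv.2
    · rintro ⟨s, t⟩ hb
      simp only [Finset.mem_product, Finset.mem_univ, Finset.mem_range, true_and] at hb
      obtain ⟨v, h1, h2, h3⟩ := C.code_surj s k t hk hb
      exact ⟨v, by simpa using h1, by simp [h2, h3]⟩
  rw [this, Finset.card_product]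
  simp

theorem sum_lev (C : Coord G z h P lev par side code) (g : ℕ → ℤ) :
    ∑ v, g (lev v) = z * g 0 + ∑ k ∈ Finset.range h, 2 * P k * g (k + 1) := by
  have h1 : ∀ v ∈ (Finset.univ : Finset V), lev v ∈ Finset.range (h + 1) := by
    intro v _
    have := C.lev_le v
    simp; omega
  rw [← Finset.sum_fiberwise_of_maps_to h1, Finset.sum_range_succ']
  have h2 : ∀ k, ∑ v with lev v = k, g (lev v) = (Finset.univ.filter fun v => lev v = k).card * g k
      := by
    intro k
    rw [Finset.sum_congr rfl (g := fun _ => g k)]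
    · simp
    · intro v hv
      simp at hv
      rw [hv]
  simp only [h2, C.card_lev_zero]
  rw [add_comm]
  congr 1
  refine Finset.sum_congr rfl fun k hk => ?_
  rw [C.card_lev_succ (Finset.mem_range.1 hk)]
  push_cast
  ring

end Coord

/-! ### The lower bound: excesses in the order of the labels. -/

theorem exists_increasing_enumeration [Fintype V] [Nonempty V] (f : V → ℕ)
    (hf : Function.Injective f) :
    ∃ x : ℕ → V, (∀ i j, i < j → j < Fintype.card V → f (x i) < f (x j)) ∧
      ∀ g : V → ℤ, ∑ i ∈ Finset.range (Fintype.card V), g (x i) = ∑ v, g v := by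
  let _ : LinearOrder V := LinearOrder.lift' f hf
  let e : Fin (Fintype.card V) ≃o V := monoEquivOfFin V rfl
  refine ⟨fun i => if hi : i < Fintype.card V then e ⟨i, hi⟩ else Classical.arbitrary V, ?_, ?_⟩
  · intro i j hij hj
    simp only [dif_pos hj, dif_pos (hij.trans hj)]
    have : e ⟨i, hij.trans hj⟩ < e ⟨j, hj⟩ := e.strictMono (by simpa using hij)
    exact this
  · intro g
    rw [Finset.sum_range, ← Equiv.sum_comp e.toEquiv]
    refine Finset.sum_congr rfl fun i _ => ?_
    simp

theorem abs_sub_le_span [Fintype V] (f : V → ℕ) (u v : V) :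
    |(f u : ℤ) - f v| ≤ span f := by
  have : ((f u : ℤ) - (f v : ℤ)).natAbs ≤ span f :=
    Finset.le_sup (f := fun p : V × V => ((f p.1 : ℤ) - (f p.2 : ℤ)).natAbs)
      (Finset.mem_univ (u, v))
  rw [Int.abs_eq_natAbs]
  exact_mod_cast this

theorem sum_range_interior (g : ℕ → ℤ) (K : ℕ) :
    ∑ i ∈ Finset.range K, g (i + 1) = ∑ i ∈ Finset.range (K + 2), g i - g 0 - g (K + 1) := by
  rw [Finset.sum_range_succ, Finset.sum_range_succ']
  ring

/-- The span of a labelling written in terms of the levels `L i` and the excesses `e i` of the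
consecutive differences. -/
theorem telescope_excess (a L e : ℕ → ℤ) (c : ℤ)
    (he : ∀ i, a (i + 1) - a i = c - L i - L (i + 1) + e i) (K : ℕ) :
    a K - a 0 = ∑ i ∈ Finset.range (K + 1), (c - 2 * L i) - c + L 0 + L K
      + ∑ i ∈ Finset.range K, e i := by
  induction K with
  | zero => simp; ring
  | succ K ih =>
    rw [Finset.sum_range_succ _ (K + 1), Finset.sum_range_succ e K]
    linarith [he K]

namespace Coord

variable {G : SimpleGraph V} {z h : ℕ} {P : ℕ → ℕ} {lev : V → ℕ} {par : V → V} {side : V → Bool}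
  {code : V → ℕ}

/-- Of three vertices outside the center, two lie in the same half. -/
theorem le_excess (C : Coord G z h P lev par side code) {f : V → ℕ}
    (hf : ∀ u v, u ≠ v → (2 * h + z : ℤ) - G.dist u v ≤ |(f u : ℤ) - f v|) {u v w : V}
    (huv : f u < f v) (hvw : f v < f w) (hu : lev u ≠ 0) (hv : lev v = h) (hw : lev w ≠ 0) :
    (z : ℤ) + (4 * h + 2 - lev u - 2 * lev v - lev w) ≤ (f w : ℤ) - f u := by
  have h1 := hf v u (by rintro rfl; omega)
  have h2 := hf w v (by rintro rfl; omega)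
  have h3 := hf w u (by rintro rfl; omega)
  rw [abs_of_pos (by omega)] at h1 h2 h3
  have d1 := C.dist_le v u
  have d2 := C.dist_le w v
  have hz := C.z_eq
  have hh := C.h_pos
  by_cases s1 : side v = side u
  · have := C.dist_le_of_side_eq (by omega) hu s1
    omega
  by_cases s2 : side w = side v
  · have := C.dist_le_of_side_eq hw (by omega) s2
    omega
  have s3 : side w = side u := by
    cases hsu : side u <;> cases hsv : side v <;> cases hsw : side w <;> simp_all
  have := C.dist_le_of_side_eq hw hu s3
  omega

variable [Fintype V]

theorem sum_leaf (C : Coord G z h P lev par side code) :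
    ∑ v, (if lev v = h then (1 : ℤ) else 0) = 2 * P (h - 1) := by
  have hh := C.h_pos
  have := C.card_lev_succ (k := h - 1) (by omega)
  rw [Nat.sub_add_cancel hh] at this
  rw [Finset.sum_boole, this]
  push_cast
  ring

theorem sum_central (C : Coord G z h P lev par side code) :
    ∑ v, (if lev v = 0 then (1 : ℤ) else 0) = z := by
  rw [Finset.sum_boole, C.card_lev_zero]

theorem le_span (C : Coord G z h P lev par side code) (hzh : z = 2 ∨ 2 ≤ h) {f : V → ℕ}
    (hf : ∀ u v, u ≠ v → (2 * h + z : ℤ) - G.dist u v ≤ |(f u : ℤ) - f v|) :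
    ∑ v, (2 * (h : ℤ) + 1 - 2 * lev v) - (2 * h + 1)
      + (if z = 1 then (P (h - 1) : ℤ) + 1 else 2 * P (h - 1) - 2) ≤ span f := by
  have hz := C.z_eq
  have hh := C.h_pos
  have : Nonempty V := C.connected.nonempty
  have hinj : Function.Injective f := by
    intro u v huv
    by_contra hne
    have h1 := hf u v hne
    rw [huv, sub_self, abs_zero] at h1
    have h2 := C.dist_le u v
    have h3 := C.lev_le u
    have h4 := C.lev_le v
    omega
  have hcard : 2 ≤ Fintype.card V := by
    obtain ⟨c, hc, -⟩ := C.zero_exists true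
    obtain ⟨d, hd, -⟩ := C.one_exists true
    exact Fintype.one_lt_card_iff.2 ⟨c, d, by rintro rfl; omega⟩
  obtain ⟨x, hx, hsum⟩ := exists_increasing_enumeration f hinj
  obtain ⟨K, hK⟩ : ∃ K, Fintype.card V = K + 2 := ⟨_, (Nat.sub_add_cancel hcard).symm⟩
  rw [hK] at hx hsum
  obtain ⟨e, he⟩ : ∃ e : ℕ → ℤ, ∀ i, (f (x (i + 1)) : ℤ) - f (x i) =
      (2 * h + 1) - lev (x i) - lev (x (i + 1)) + e i :=
    ⟨fun i => (f (x (i + 1)) : ℤ) - f (x i) - ((2 * h + 1) - lev (x i) - lev (x (i + 1))),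
      fun i => by ring⟩
  have he0 : ∀ i, i < K + 1 → 0 ≤ e i := by
    intro i hi
    have h1 := hx i (i + 1) (by omega) (by omega)
    have h2 := hf (x (i + 1)) (x i) (fun h => by rw [h] at h1; omega)
    rw [abs_of_pos (by omega), he i] at h2
    have h3 := C.dist_le (x (i + 1)) (x i)
    omega
  have htel := telescope_excess (fun i => (f (x i) : ℤ)) (fun i => (lev (x i) : ℤ)) e
    (2 * h + 1) he (K + 1)
  rw [hsum (fun v => 2 * (h : ℤ) + 1 - 2 * lev v)] at htel
  have hspan := (le_abs_self _).trans (abs_sub_le_span f (x (K + 1)) (x 0))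
  set leaf : ℕ → ℤ := fun i => if lev (x i) = h then 1 else 0 with hleaf
  set cen : ℕ → ℤ := fun i => if lev (x i) = 0 then 1 else 0 with hcen
  -- The bound from three consecutive vertices applies only if the outer two are noncentral.
  -- Subtracting the indicators `cen` makes the left side nonpositive otherwise, at a total cost of
  -- at most two units of `z` per central vertex.
  have hpt : ∀ i ∈ Finset.range K,
      z * (leaf (i + 1) - cen i - cen (i + 2)) ≤ e i + e (i + 1) := by
    intro i hi
    rw [Finset.mem_range] at hi
    have h1 := he0 i (by omega)
    have h2 := he0 (i + 1) (by omega)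
    have h3 := he i
    have h4 := he (i + 1)
    by_cases hgood : lev (x (i + 1)) = h ∧ lev (x i) ≠ 0 ∧ lev (x (i + 2)) ≠ 0
    · have := C.le_excess hf (hx i (i + 1) (by omega) (by omega))
        (hx (i + 1) (i + 2) (by omega) (by omega)) hgood.2.1 hgood.1 hgood.2.2
      simp only [hleaf, hcen, if_pos hgood.1, if_neg hgood.2.1, if_neg hgood.2.2]
      rw [show i + 1 + 1 = i + 2 from rfl] at h4
      linarith
    · have : leaf (i + 1) - cen i - cen (i + 2) ≤ 0 := by
        simp only [hleaf, hcen]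
        split_ifs <;> omega
      have : (z : ℤ) * (leaf (i + 1) - cen i - cen (i + 2)) ≤ 0 :=
        mul_nonpos_of_nonneg_of_nonpos (by positivity) this
      linarith
  have hsums := Finset.sum_le_sum hpt
  rw [← Finset.mul_sum, Finset.sum_sub_distrib, Finset.sum_sub_distrib, Finset.sum_add_distrib,
    sum_range_interior] at hsums
  have hE1 : ∑ i ∈ Finset.range K, e i = ∑ i ∈ Finset.range (K + 1), e i - e K := by
    rw [Finset.sum_range_succ]; ring
  have hE2 : ∑ i ∈ Finset.range K, e (i + 1) = ∑ i ∈ Finset.range (K + 1), e i - e 0 := by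
    rw [Finset.sum_range_succ']; ring
  have hC1 : ∑ i ∈ Finset.range K, cen i =
      ∑ i ∈ Finset.range (K + 2), cen i - cen K - cen (K + 1) := by
    rw [Finset.sum_range_succ, Finset.sum_range_succ]; ring
  have hC2 : ∑ i ∈ Finset.range K, cen (i + 2) =
      ∑ i ∈ Finset.range (K + 2), cen i - cen 0 - cen 1 := by
    rw [Finset.sum_range_succ', Finset.sum_range_succ']; ring
  have hL : ∑ i ∈ Finset.range (K + 2), leaf i = 2 * P (h - 1) :=
    (hsum fun v => if lev v = h then 1 else 0).trans C.sum_leaf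
  have hCe : ∑ i ∈ Finset.range (K + 2), cen i = z :=
    (hsum fun v => if lev v = 0 then 1 else 0).trans C.sum_central
  rw [hE1, hE2, hC1, hC2, hL, hCe] at hsums
  have hEnn : 0 ≤ ∑ i ∈ Finset.range (K + 1), e i :=
    Finset.sum_nonneg fun i hi => he0 i (Finset.mem_range.1 hi)
  have c0 : ∀ i, 0 ≤ cen i := fun i => by simp only [hcen]; split_ifs <;> omega
  have e0 := he0 0 (by omega)
  have eK := he0 K (by omega)
  have cK := c0 K
  have c1 := c0 1
  have key : (if z = 1 then (P (h - 1) : ℤ) + 1 else 2 * P (h - 1) - 2) ≤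
      lev (x 0) + lev (x (K + 1)) + ∑ i ∈ Finset.range (K + 1), e i := by
    -- The ends of the list are distinct, so a unique central vertex can occupy only one of them.
    have hends : lev (x 0) = 0 → lev (x (K + 1)) = 0 → z ≠ 1 := by
      intro h1 h2 h3
      have := hx 0 (K + 1) (by omega) (by omega)
      rw [C.zero_unique _ _ h1 h2 (by omega)] at this
      exact lt_irrefl _ this
    generalize (∑ i ∈ Finset.range (K + 1), e i) = E at *
    -- A leaf at an end weakens the bound on the excess, which its level `h ≥ 2` makes up for. When
    -- `h = 1`, only `z = 2` is left, and the bound to be shown is `0`.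
    by_cases hh1 : h = 1
    · have h2 : z = 2 := by omega
      rw [if_neg (by omega), hh1]
      simp only [le_refl, tsub_eq_zero_of_le, C.P_zero]
      push_cast
      omega
    · have h0 : leaf 0 = if lev (x 0) = h then 1 else 0 := rfl
      have h1 : leaf (K + 1) = if lev (x (K + 1)) = h then 1 else 0 := rfl
      have h2 : cen 0 = if lev (x 0) = 0 then 1 else 0 := rfl
      have h3 : cen (K + 1) = if lev (x (K + 1)) = 0 then 1 else 0 := rfl
      clear_value leaf cen
      rcases hz with rfl | rfl
      · simp only [if_true, Nat.cast_one, one_mul] at hsums ⊢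
        split_ifs at h0 h1 h2 h3 <;> omega
      · rw [if_neg (by norm_num)]
        push_cast at hsums
        split_ifs at h0 h1 h2 h3 <;> omega
  linarith

end Coord

/-! ### The upper bound: a criterion for an enumeration to give a radio labelling. -/

namespace Coord

variable {G : SimpleGraph V} {z h : ℕ} {P : ℕ → ℕ} {lev : V → ℕ} {par : V → V} {side : V → Bool}
  {code : V → ℕ}

/-- The overlap counts levels `j` with `2 ^ j ≤ 2 * s`, so it is at most `log₂ s + 1`. This is below
`s` from `s = 3` on, and equals `s` for `s = 1, 2`. -/
theorem overlap_le (u v : V) (s : ℕ) (hs : 1 ≤ s)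
    (hsep : ∀ j, 1 ≤ j → j ≤ lev u → j ≤ lev v → side u = side v →
      code u % P (j - 1) = code v % P (j - 1) → 2 ^ j ≤ 2 * s) :
    overlap P lev side code u v ≤ if s ≤ 2 then s else s - 1 := by
  refine (Finset.card_le_card (t := Finset.Icc 1 (if s ≤ 2 then s else s - 1)) ?_).trans
    (by simp)
  intro j hj
  simp only [Finset.mem_filter, Finset.mem_Icc, le_min_iff] at hj ⊢
  obtain ⟨⟨h1, h2, h3⟩, h4, h5⟩ := hj
  refine ⟨h1, ?_⟩
  have key := hsep j h1 h2 h3 h4 h5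
  by_contra hlt
  split_ifs at hlt with h6
  · have : 2 ^ (s + 1) ≤ 2 ^ j := Nat.pow_le_pow_right (by norm_num) (by omega)
    interval_cases s <;> omega
  · have h7 : 2 ^ s ≤ 2 ^ j := Nat.pow_le_pow_right (by norm_num) (by omega)
    obtain ⟨t, rfl⟩ : ∃ t, s = t + 3 := ⟨s - 3, by omega⟩
    have h8 := Nat.lt_two_pow_self (n := t)
    rw [pow_add] at h7
    omega

/-- Each further step adds at least `2 * h + 1 - 2 * L ≥ 1` to the excess over `2 * h + 1 - L p - L
(p + d)`, since levels are at most `h`. -/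
theorem excess_growth {g L : ℕ → ℤ} {E : ℕ → ℕ}
    (hL : ∀ i, L i ≤ h) (hg : ∀ i, g (i + 1) - g i = 2 * h + 1 - L i - L (i + 1) + E i)
    (p d d' : ℕ) (hd : d ≤ d') :
    g (p + d) - g p - (2 * h + 1 - L p - L (p + d)) + (d' - d) ≤
      g (p + d') - g p - (2 * h + 1 - L p - L (p + d')) := by
  induction d', hd using Nat.le_induction with
  | base => simp
  | succ d' _ ih =>
    have h1 := hg (p + d')
    have h2 := hL (p + d')
    rw [← add_assoc]
    push_cast
    linarith

/-- An enumeration of the vertices that alternates between the halves and keeps apart vertices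
with a large overlap yields a radio labelling, if the excesses `E` compensate for
consecutive leaves. -/
theorem exists_labelling [Fintype V] (C : Coord G z h P lev par side code) (pos : V → ℕ)
    (hinj : Function.Injective pos) (hlt : ∀ v, pos v < Fintype.card V) (E : ℕ → ℕ)
    (hparity : ∀ u v, side u = side v → (z = 2 ∨ (lev u ≠ 0 ∧ lev v ≠ 0)) →
      pos u % 2 = pos v % 2)
    (hsep : ∀ u v j, u ≠ v → 1 ≤ j → j ≤ lev u → j ≤ lev v → side u = side v →
      code u % P (j - 1) = code v % P (j - 1) → pos u < pos v → 2 ^ j ≤ pos v - pos u)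
    (hcen : ∀ v, lev v = 0 → pos v = 0 ∨ pos v + 1 = Fintype.card V)
    (hbonus : ∀ u v w, pos v = pos u + 1 → pos w = pos u + 2 → lev u ≠ 0 → lev v ≠ 0 →
      lev w ≠ 0 → lev v + 1 ≤ h ∨ z ≤ E (pos u) ∨ z ≤ E (pos v))
    (a b : V) (ha : pos a = 0) (hb : pos b + 1 = Fintype.card V) :
    ∃ f : V → ℕ, (∀ u v, u ≠ v → (2 * h + z : ℤ) - G.dist u v ≤ |(f u : ℤ) - f v|) ∧
      (span f : ℤ) ≤ ∑ v, (2 * (h : ℤ) + 1 - 2 * lev v) - (2 * h + 1) + lev a + lev b +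
        ∑ i ∈ Finset.range (Fintype.card V - 1), (E i : ℤ) := by
  have : Nonempty V := ⟨a⟩
  have hz := C.z_eq
  set n := Fintype.card V with hn
  obtain ⟨x, hx⟩ : ∃ x : ℕ → V, ∀ v, x (pos v) = v :=
    ⟨Function.invFun pos, Function.leftInverse_invFun hinj⟩
  have hsurj : ∀ i, i < n → ∃ v, pos v = i := by
    have hbij : Function.Bijective (fun v => (⟨pos v, hlt v⟩ : Fin n)) := by
      rw [Fintype.bijective_iff_injective_and_card]
      exact ⟨fun u v huv => hinj (by simpa using huv), by simp [hn]⟩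
    intro i hi
    obtain ⟨v, hv⟩ := hbij.2 ⟨i, hi⟩
    exact ⟨v, by simpa using hv⟩
  have hpx : ∀ i, i < n → pos (x i) = i := by
    intro i hi
    obtain ⟨v, rfl⟩ := hsurj i hi
    rw [hx]
  obtain ⟨L, hLdef⟩ : ∃ L : ℕ → ℤ, ∀ i, L i = lev (x i) := ⟨_, fun _ => rfl⟩
  have hLv : ∀ v, L (pos v) = lev v := fun v => by rw [hLdef, hx]
  have hL : ∀ i, L i ≤ h := fun i => by rw [hLdef]; exact_mod_cast C.lev_le _
  obtain ⟨g, hg0, hg⟩ : ∃ g : ℕ → ℤ, g 0 = 0 ∧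
      ∀ i, g (i + 1) - g i = 2 * h + 1 - L i - L (i + 1) + E i := by
    refine ⟨fun i => ∑ j ∈ Finset.range i, (2 * h + 1 - L j - L (j + 1) + E j), by simp, ?_⟩
    intro i
    simp only [Finset.sum_range_succ]
    ring
  have hmono : Monotone g := by
    refine monotone_nat_of_le_succ fun i => ?_
    have h1 := hg i
    have h2 := hL i
    have h3 := hL (i + 1)
    omega
  have hgnn : ∀ i, 0 ≤ g i := fun i => hg0 ▸ hmono (Nat.zero_le i)
  have hfg : ∀ v, (((g (pos v)).toNat : ℕ) : ℤ) = g (pos v) := fun v => Int.toNat_of_nonneg (hgnn _)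
  refine ⟨fun v => (g (pos v)).toNat, ?_, ?_⟩
  · have main : ∀ u v, pos u < pos v →
        (2 * h + z : ℤ) - G.dist u v ≤ g (pos v) - g (pos u) := by
      intro u v huv
      obtain ⟨d, hd⟩ := Nat.exists_eq_add_of_lt huv
      have hd : pos v = pos u + (d + 1) := by omega
      have hne : u ≠ v := by rintro rfl; omega
      have hdist := C.le_dist u v
      have hgrow := excess_growth hL hg (pos u) 1 (d + 1) (by omega)
      have h1 := hg (pos u)
      rw [← hd] at hgrow
      rw [hLv u] at h1
      rw [hLv u, hLv v] at hgrow
      have hR : (d : ℤ) ≤ g (pos v) - g (pos u) - (2 * h + 1 - lev u - lev v) := by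
        push_cast at hgrow
        linarith
      by_cases hs : side u = side v
      · rw [if_pos hs] at hdist
        by_cases hc : lev u = 0 ∨ lev v = 0
        · rw [overlap_of_lev_eq_zero hc] at hdist
          rcases hz with rfl | rfl
          · push_cast at *; linarith
          -- The positions have equal parity, so `d ≥ 1`, which covers the missing `z - 1`.
          · have := hparity u v hs (Or.inl rfl)
            push_cast at *
            omega
        · push Not at hc
          have hpar := hparity u v hs (Or.inr hc)
          obtain ⟨s, hs2⟩ : ∃ s, d + 1 = 2 * s := ⟨(d + 1) / 2, by omega⟩
          have hov := overlap_le (P := P) (lev := lev) (side := side) (code := code) u v s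
            (by omega) (fun j j1 j2 j3 j4 j5 => by
              have := hsep u v j hne j1 j2 j3 j4 j5 huv
              omega)
          -- The required excess is `z - 1 + 2 * overlap`, and growth alone gives `d = 2 * s - 1`.
          -- For `s ≥ 3` this suffices, because the overlap is at most `s - 1` and `z ≤ 2`. For `s ≤
          -- 2` a further `z` is needed; it comes from the first two gaps, either through `E` or
          -- because a nonleaf in the middle adds `2 ≥ z`.
          split_ifs at hov with hs3
          · have hbound : (z : ℤ) + d ≤ g (pos v) - g (pos u) - (2 * h + 1 - lev u - lev v) := by
              have hvn := hlt v
              have p1 := hpx (pos u + 1) (by omega)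
              have p2 := hpx (pos u + 2) (by omega)
              have l1 : lev (x (pos u + 1)) ≠ 0 := by
                intro h0
                have := hcen _ h0
                omega
              have l2 : lev (x (pos u + 2)) ≠ 0 := by
                intro h0
                rcases hcen _ h0 with h2 | h2
                · omega
                · have : x (pos u + 2) = v := hinj (by omega)
                  rw [this] at h0
                  exact hc.2 h0
              have hbon := hbonus u _ _ p1 p2 hc.1 l1 l2
              rw [p1] at hbon
              have hgrow2 := excess_growth hL hg (pos u) 2 (d + 1) (by omega)
              rw [← hd, hLv u, hLv v] at hgrow2
              have h2 := hg (pos u + 1)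
              have h3 := hL (pos u + 1)
              have h4 := hLdef (pos u + 1)
              rw [show pos u + 1 + 1 = pos u + 2 from rfl] at h2
              push_cast at hgrow2
              omega
            omega
          · omega
      · rw [if_neg hs, overlap_of_side_ne hs] at hdist
        push_cast at hdist
        linarith
    intro u v hne
    simp only [hfg]
    rcases lt_trichotomy (pos u) (pos v) with hlt' | heq | hgt
    · rw [abs_sub_comm]
      exact (main u v hlt').trans (le_abs_self _)
    · exact absurd (hinj heq) hne
    · rw [SimpleGraph.dist_comm]
      exact (main v u hgt).trans (le_abs_self _)
  · have htel := telescope_excess g L (fun i => (E i : ℤ)) (2 * h + 1) hg (n - 1)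
    have hnpos : n - 1 + 1 = n := by omega
    have hsum : ∑ i ∈ Finset.range n, (2 * (h : ℤ) + 1 - 2 * L i) =
        ∑ v, (2 * (h : ℤ) + 1 - 2 * lev v) := by
      refine Finset.sum_nbij' x pos (by simp) (by simp [hlt]) ?_ (by simp [hx]) (by simp [hLdef])
      intro i hi
      exact hpx i (Finset.mem_range.1 hi)
    have hb' : n - 1 = pos b := by omega
    have hLa : L 0 = lev a := by rw [← ha, hLv]
    have hLb : L (n - 1) = lev b := by rw [hb', hLv]
    rw [hnpos, hsum, hg0, sub_zero, hLa, hLb] at htel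
    rw [← htel]
    have hle : span (fun v => (g (pos v)).toNat) ≤ (g (n - 1)).toNat := by
      refine Finset.sup_le fun p _ => ?_
      have h1 := hmono (show pos p.1 ≤ n - 1 by have := hlt p.1; omega)
      have h2 := hmono (show pos p.2 ≤ n - 1 by have := hlt p.2; omega)
      have h3 := hgnn (pos p.1)
      have h4 := hgnn (pos p.2)
      simp only
      omega
    have := hgnn (n - 1)
    omega

end Coord

/-! ### The two explicit enumerations, for one and for two central vertices. -/

/-- The number of vertices of a half below level `l`. -/
def below (P : ℕ → ℕ) (h l : ℕ) : ℕ := ∑ i ∈ Finset.Ico l h, P i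

/-- The index of `v` when its half is enumerated level by level, starting with the leaves. -/
def rank (P : ℕ → ℕ) (h : ℕ) (lev code : V → ℕ) (v : V) : ℕ := code v + below P h (lev v)

theorem below_eq (P : ℕ → ℕ) {h l : ℕ} (hl : l < h) :
    below P h l = P l + below P h (l + 1) :=
  Finset.sum_eq_sum_Ico_succ_bot hl P

theorem below_antitone (P : ℕ → ℕ) (h : ℕ) : Antitone (below P h) := fun _ _ hab =>
  Finset.sum_le_sum_of_subset (Finset.Ico_subset_Ico_left hab)

theorem sum_indicator_le {M B : ℕ} (Q : ℕ → Prop) [DecidablePred Q] (A z : ℕ)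
    (hQ : ∀ i, Q i → A ≤ i / 2 ∧ i / 2 < B) (hpar : ∀ i j, Q i → Q j → i % 2 = j % 2) :
    ∑ i ∈ Finset.range M, (((if Q i then z else 0 : ℕ)) : ℤ) ≤ z * ((B - A : ℕ) : ℤ) := by
  rw [← Nat.cast_sum, ← Finset.sum_filter, Finset.sum_const, smul_eq_mul, mul_comm]
  have : ((Finset.range M).filter Q).card ≤ (Finset.Ico A B).card := by
    refine Finset.card_le_card_of_injOn (fun i => i / 2) ?_ ?_
    · intro i hi
      simp only [Finset.coe_filter, Set.mem_ofPred_eq] at hi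
      simpa using hQ i hi.2
    · intro i hi j hj hij
      simp only [Finset.coe_filter, Set.mem_ofPred_eq] at hi hj hij
      have := hpar i j hi.2 hj.2
      omega
  rw [Nat.card_Ico] at this
  exact_mod_cast Nat.mul_le_mul_left z this

namespace Coord

variable {G : SimpleGraph V} {z h : ℕ} {P : ℕ → ℕ} {lev : V → ℕ} {par : V → V} {side : V → Bool}
  {code : V → ℕ}

theorem rank_lt_below (C : Coord G z h P lev par side code) {v : V} (hv : lev v ≠ 0) :
    rank P h lev code v < below P h (lev v - 1) := by
  have h1 := C.code_lt v hv
  have h2 := C.lev_le v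
  rw [below_eq P (by omega), Nat.sub_add_cancel (by omega)]
  unfold rank
  omega

theorem lev_eq_of_rank_eq (C : Coord G z h P lev par side code) {u v : V} (hu : lev u ≠ 0)
    (hv : lev v ≠ 0) (huv : rank P h lev code u = rank P h lev code v) : lev u = lev v := by
  have key : ∀ a b, lev b ≠ 0 → lev a < lev b → rank P h lev code b < rank P h lev code a := by
    intro a b hb hab
    refine (C.rank_lt_below hb).trans_le ((below_antitone P h (show lev a ≤ lev b - 1 by omega)).trans
      (Nat.le_add_left _ _))
  rcases lt_trichotomy (lev u) (lev v) with hlt | heq | hgt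
  · exact absurd (key u v hv hlt) (by omega)
  · exact heq
  · exact absurd (key v u hu hgt) (by omega)

theorem eq_of_rank_eq (C : Coord G z h P lev par side code) {u v : V} (hu : lev u ≠ 0)
    (hv : lev v ≠ 0) (hs : side u = side v)
    (huv : rank P h lev code u = rank P h lev code v) : u = v := by
  have h1 := C.lev_eq_of_rank_eq hu hv huv
  refine C.code_inj u v hu h1 hs ?_
  unfold rank at huv
  rw [h1] at huv
  omega

theorem lev_lt_of_le_rank (C : Coord G z h P lev par side code) {v : V} (hv : lev v ≠ 0)
    (hr : P (h - 1) ≤ rank P h lev code v) : lev v < h := by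
  by_contra hlt
  have h1 := C.lev_le v
  have h2 := C.code_lt v hv
  have h3 : lev v = h := by omega
  rw [h3] at h2
  unfold rank below at hr
  rw [h3, Finset.Ico_self, Finset.sum_empty] at hr
  omega

/-- The first `k` levels of a half contain at least `1 + 2 + ⋯ + 2 ^ (k - 1) = 2 ^ k - 1` vertices.
-/
theorem two_pow_add_below_le (C : Coord G z h P lev par side code) {k : ℕ} (hk : k ≤ h) :
    2 ^ k + below P h k ≤ below P h 0 + 1 := by
  induction k with
  | zero => omega
  | succ k ih =>
    have h1 := ih (by omega)
    have h2 := C.two_pow_le_P (i := k) (by omega)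
    rw [below_eq P (by omega)] at h1
    rw [pow_succ]
    omega

theorem rank_add_two_pow_le (C : Coord G z h P lev par side code) {v : V} (hv : lev v ≠ 0) :
    rank P h lev code v + 2 ^ (lev v - 1) ≤ below P h 0 := by
  have h1 := C.lev_le v
  have h2 := C.rank_lt_below hv
  have h3 := C.two_pow_add_below_le (k := lev v - 1) (by omega)
  omega

/-- The offset of a level is a sum of `P i` with `i ≥ lev v`, all divisible by `P (j - 1)`; hence
ranks see the same ancestors as codes, even across levels. -/
theorem rank_mod (C : Coord G z h P lev par side code) {v : V} {j : ℕ} (h1 : 1 ≤ j)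
    (h2 : j ≤ lev v) : rank P h lev code v % P (j - 1) = code v % P (j - 1) := by
  have hd : P (j - 1) ∣ below P h (lev v) := by
    refine Finset.dvd_sum fun i hi => C.P_dvd ?_ ?_ <;> rw [Finset.mem_Ico] at hi <;> omega
  obtain ⟨c, hc⟩ := hd
  unfold rank
  rw [hc, Nat.add_mul_mod_self_left]

theorem two_pow_le_rank_sub (C : Coord G z h P lev par side code) {u v : V} {j : ℕ}
    (h1 : 1 ≤ j) (h2 : j ≤ lev u) (h3 : j ≤ lev v)
    (hc : code u % P (j - 1) = code v % P (j - 1))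
    (hlt : rank P h lev code u < rank P h lev code v) :
    2 ^ j ≤ 2 * (rank P h lev code v - rank P h lev code u) := by
  have hmod : rank P h lev code u ≡ rank P h lev code v [MOD P (j - 1)] := by
    unfold Nat.ModEq
    rw [C.rank_mod h1 h2, C.rank_mod h1 h3, hc]
  have hd := (Nat.modEq_iff_dvd' hlt.le).1 hmod
  have h4 := Nat.le_of_dvd (by omega) hd
  have h5 := C.lev_le u
  have h6 := C.two_pow_le_P (i := j - 1) (by omega)
  have h7 : 2 ^ j = 2 * 2 ^ (j - 1) := by rw [← pow_succ', Nat.sub_add_cancel h1]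
  omega

theorem P_le_below (C : Coord G z h P lev par side code) : P (h - 1) ≤ below P h 0 := by
  have := C.h_pos
  exact Finset.single_le_sum (f := P) (fun _ _ => Nat.zero_le _) (by simp; omega)

theorem exists_rank_eq_last (C : Coord G z h P lev par side code) (s : Bool) :
    ∃ v, lev v = 1 ∧ side v = s ∧ rank P h lev code v + 1 = below P h 0 := by
  obtain ⟨v, hv, hs⟩ := C.one_exists s
  refine ⟨v, hv, hs, ?_⟩
  have h1 := C.code_lt v (by omega)
  have h2 := C.h_pos
  rw [below_eq P (by omega), C.P_zero, zero_add]
  unfold rank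
  rw [hv] at h1 ⊢
  rw [Nat.sub_self, C.P_zero] at h1
  omega

variable [Fintype V]

theorem card_eq (C : Coord G z h P lev par side code) :
    Fintype.card V = z + 2 * below P h 0 := by
  have := C.sum_lev (fun _ => 1)
  simp only [Finset.sum_const, Finset.card_univ, nsmul_eq_mul, mul_one, ← Finset.mul_sum] at this
  unfold below
  rw [← Finset.range_eq_Ico]
  exact_mod_cast this

theorem exists_labelling_one (C : Coord G 1 h P lev par side code) :
    ∃ f : V → ℕ, (∀ u v, u ≠ v → (2 * h + (1 : ℕ) : ℤ) - G.dist u v ≤ |(f u : ℤ) - f v|) ∧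
      (span f : ℤ) ≤ ∑ v, (2 * (h : ℤ) + 1 - 2 * lev v) - (2 * h + 1) + (P (h - 1) + 1) := by
  -- The center comes first, then the halves alternate by rank, ending at a level-1 vertex; the end
  -- levels contribute `0 + 1`.
  obtain ⟨pos, hpos⟩ : ∃ pos : V → ℕ, ∀ v, pos v = if lev v = 0 then 0 else
    2 * rank P h lev code v + if side v then 2 else 1 := ⟨_, fun _ => rfl⟩
  have hcard := C.card_eq
  have hrk : ∀ v, lev v ≠ 0 → rank P h lev code v < below P h 0 := fun v hv => by
    have := C.rank_add_two_pow_le hv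
    have := Nat.two_pow_pos (lev v - 1)
    omega
  obtain ⟨c, hc, -⟩ := C.zero_exists true
  obtain ⟨b, hb, hbs, hbr⟩ := C.exists_rank_eq_last true
  have hposc : pos c = 0 := by rw [hpos, if_pos hc]
  have hposb : pos b + 1 = Fintype.card V := by
    rw [hpos, if_neg (by omega), if_pos hbs]
    omega
  refine Exists.imp ?_ (C.exists_labelling pos ?_ ?_
    -- One unit of excess between the two leaves of equal rank, `P (h - 1)` units in all.
    (fun i => if i % 2 = 1 ∧ i / 2 < P (h - 1) then 1 else 0) ?_ ?_ ?_ ?_ c b hposc hposb)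
  · rintro f ⟨hf, hspan⟩
    refine ⟨hf, hspan.trans ?_⟩
    have := sum_indicator_le (M := Fintype.card V - 1) (B := P (h - 1))
      (fun i => i % 2 = 1 ∧ i / 2 < P (h - 1)) 0 1 (fun i hi => ⟨Nat.zero_le _, hi.2⟩)
      (fun i j hi hj => hi.1.trans hj.1.symm)
    rw [hc, hb]
    rw [Nat.sub_zero] at this
    push_cast at this ⊢
    linarith
  · intro u v huv
    rw [hpos, hpos] at huv
    by_cases hu : lev u = 0 <;> by_cases hv : lev v = 0
    · exact C.zero_unique u v hu hv (by simp)
    · rw [if_pos hu, if_neg hv] at huv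
      split_ifs at huv
    · rw [if_neg hu, if_pos hv] at huv
      split_ifs at huv
    · rw [if_neg hu, if_neg hv] at huv
      refine C.eq_of_rank_eq hu hv ?_ ?_
      · cases hsu : side u <;> cases hsv : side v <;> simp [hsu, hsv] at huv ⊢ <;> omega
      · split_ifs at huv <;> omega
  · intro v
    rw [hpos]
    split_ifs with h1 h2
    · omega
    · have := hrk v h1; omega
    · have := hrk v h1; omega
  · rintro u v hs (h1 | ⟨hu, hv⟩)
    · omega
    · rw [hpos, hpos, if_neg hu, if_neg hv, hs]
      omega
  · intro u v j _ h1 h2 h3 hs hcode hlt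
    rw [hpos u, hpos v, if_neg (show ¬ lev u = 0 by omega), if_neg (show ¬ lev v = 0 by omega),
      hs] at hlt ⊢
    have := C.two_pow_le_rank_sub h1 h2 h3 hcode (by omega)
    omega
  · intro v hv
    left
    rw [hpos, if_pos hv]
  · intro u v w hv hw hu0 hv0 _
    have hv1 := hpos v
    have hu1 := hpos u
    rw [if_neg hu0] at hu1
    rw [if_neg hv0] at hv1
    by_cases hr : P (h - 1) ≤ rank P h lev code v
    · exact Or.inl (C.lev_lt_of_le_rank hv0 hr)
    · right
      cases hsu : side u <;> cases hsv : side v <;> simp [hsu, hsv] at hu1 hv1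
      · omega
      · left
        rw [if_pos (by omega)]
      · right
        rw [if_pos (by omega)]
      · omega

theorem exists_labelling_two (C : Coord G 2 h P lev par side code) :
    ∃ f : V → ℕ, (∀ u v, u ≠ v → (2 * h + (2 : ℕ) : ℤ) - G.dist u v ≤ |(f u : ℤ) - f v|) ∧
      (span f : ℤ) ≤ ∑ v, (2 * (h : ℤ) + 1 - 2 * lev v) - (2 * h + 1) + (2 * P (h - 1) - 2) := by
  have hcard := C.card_eq
  have hPpos := C.P_pos (i := h - 1) (by have := C.h_pos; omega)
  have hPle := C.P_le_below
  set N := below P h 0 with hN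
  set r := rank P h lev code with hr
  have hrk' : ∀ v, lev v ≠ 0 → r v + 2 ^ (lev v - 1) ≤ N := fun v hv => C.rank_add_two_pow_le hv
  have hrk : ∀ v, lev v ≠ 0 → r v < N := fun v hv => by
    have := hrk' v hv
    have := Nat.two_pow_pos (lev v - 1)
    omega
  -- One half is shifted cyclically, so that its rank-0 leaf moves to the end of the list, next to
  -- the second central vertex. Both rank-0 leaves are then beside a central vertex and need no
  -- excess.
  obtain ⟨q, hq⟩ : ∃ q : V → ℕ, ∀ v, q v = if r v = 0 then N - 1 else r v - 1 :=
    ⟨_, fun _ => rfl⟩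
  obtain ⟨pos, hpos0, hpos⟩ : ∃ pos : V → ℕ,
      (∀ v, lev v = 0 → pos v = if side v then 0 else 2 * N + 1) ∧
      ∀ v, lev v ≠ 0 → pos v = if side v then 2 * q v + 2 else 2 * r v + 1 :=
    ⟨fun v => if lev v = 0 then if side v then 0 else 2 * N + 1 else
      if side v then 2 * q v + 2 else 2 * r v + 1, fun v hv => if_pos hv, fun v hv => if_neg hv⟩
  have hqlt : ∀ v, lev v ≠ 0 → q v < N := fun v hv => by
    have := hrk v hv
    rw [hq]
    split_ifs <;> omega
  obtain ⟨c, hc, hcs⟩ := C.zero_exists true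
  obtain ⟨d, hd, hds⟩ := C.zero_exists false
  have hposc : pos c = 0 := by rw [hpos0 c hc, if_pos (hcs rfl)]
  have hposd : pos d + 1 = Fintype.card V := by
    rw [hpos0 d hd, if_neg (by simp [hds rfl])]
    omega
  refine Exists.imp ?_ (C.exists_labelling pos ?_ ?_
    -- Two units between the leaves of equal rank `1, …, P (h - 1) - 1`, so `2 * P (h - 1) - 2` in
    -- all; both ends are central and contribute nothing.
    (fun i => if i % 2 = 0 ∧ 1 ≤ i / 2 ∧ i / 2 < P (h - 1) then 2 else 0) ?_ ?_ ?_ ?_ c d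
      hposc hposd)
  · rintro f ⟨hf, hspan⟩
    refine ⟨hf, hspan.trans ?_⟩
    have := sum_indicator_le (M := Fintype.card V - 1) (B := P (h - 1))
      (fun i => i % 2 = 0 ∧ 1 ≤ i / 2 ∧ i / 2 < P (h - 1)) 1 2 (fun i hi => hi.2)
      (fun i j hi hj => hi.1.trans hj.1.symm)
    rw [hc, hd]
    push_cast [Nat.cast_sub (show 1 ≤ P (h - 1) from hPpos)] at this ⊢
    linarith
  · intro u v huv
    have hsd : side u = side v := by
      by_cases hu : lev u = 0 <;> by_cases hv : lev v = 0 <;>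
        [rw [hpos0 u hu, hpos0 v hv] at huv; rw [hpos0 u hu, hpos v hv] at huv;
          rw [hpos u hu, hpos0 v hv] at huv; rw [hpos u hu, hpos v hv] at huv] <;>
        cases hsu : side u <;> cases hsv : side v <;> simp [hsu, hsv] at huv ⊢ <;> omega
    by_cases hu : lev u = 0 <;> by_cases hv : lev v = 0
    · exact C.zero_unique u v hu hv (fun _ => hsd)
    · have := hrk v hv
      rw [hpos0 u hu, hpos v hv, hsd] at huv
      split_ifs at huv; omega
    · have := hrk u hu
      rw [hpos u hu, hpos0 v hv, hsd] at huv
      split_ifs at huv; omega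
    · refine C.eq_of_rank_eq hu hv hsd ?_
      have := hrk u hu
      have := hrk v hv
      have hq1 := hq u
      have hq2 := hq v
      rw [hpos u hu, hpos v hv, hsd] at huv
      change r u = r v
      split_ifs at huv hq1 hq2 <;> omega
  · intro v
    by_cases hv : lev v = 0
    · rw [hpos0 v hv]
      split_ifs <;> omega
    · have := hqlt v hv
      have := hrk v hv
      rw [hpos v hv]
      split_ifs <;> omega
  · intro u v hs _
    have key : ∀ w, pos w % 2 = if side w then 0 else 1 := by
      intro w
      by_cases hw : lev w = 0
      · rw [hpos0 w hw]; split_ifs <;> omega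
      · rw [hpos w hw]; split_ifs <;> omega
    rw [key, key, hs]
  · intro u v j _ h1 h2 h3 hs hcode hlt
    have hu : lev u ≠ 0 := by omega
    have hv : lev v ≠ 0 := by omega
    have key : r u < r v → 2 ^ j ≤ 2 * (r v - r u) :=
      C.two_pow_le_rank_sub h1 h2 h3 hcode
    rw [hpos u hu, hpos v hv, hs] at hlt ⊢
    have ru := hrk u hu
    have rv := hrk v hv
    cases hsv : side v
    · rw [hsv] at hlt
      simp only [Bool.false_eq_true, if_false] at hlt ⊢
      have := key (by omega)
      omega
    · rw [hsv] at hlt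
      simp only [if_true] at hlt ⊢
      have hq1 := hq u
      have hq2 := hq v
      by_cases hr0 : r v = 0
      -- The leaf moved to the end wraps around: its distance from `u` is `2 * (N - r u)`, and
      -- enough vertices have rank at least `r u`.
      · have h4 := hrk' u hu
        have h5 : 2 ^ (j - 1) ≤ 2 ^ (lev u - 1) := Nat.pow_le_pow_right (by norm_num) (by omega)
        have h6 : 2 ^ j = 2 * 2 ^ (j - 1) := by rw [← pow_succ', Nat.sub_add_cancel h1]
        rw [if_pos hr0] at hq2
        split_ifs at hq1 <;> omega
      · rw [if_neg hr0] at hq2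
        split_ifs at hq1
        · omega
        · have := key (by omega)
          omega
  · intro v hv
    rw [hpos0 v hv]
    split_ifs
    · exact Or.inl rfl
    · right; omega
  · intro u v w hv hw hu0 hv0 hw0
    have hu1 := hpos u hu0
    have hv1 := hpos v hv0
    have hw1 := hpos w hw0
    have hq1 := hq u
    have hq2 := hq v
    have ru := hrk u hu0
    have rw' := hrk w hw0
    have rw2 := hqlt w hw0
    by_cases hr : P (h - 1) ≤ r v
    · exact Or.inl (C.lev_lt_of_le_rank hv0 hr)
    · right
      cases hsu : side u <;> cases hsv : side v <;> cases hsw : side w <;>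
        simp only [hsu, hsv, hsw, if_true, Bool.false_eq_true, if_false] at hu1 hv1 hw1 <;>
        try omega
      · right
        rw [if_pos]
        split_ifs at hq2 <;> omega
      · left
        rw [if_pos]
        omega

end Coord

/-! ### Height, diameter and coordinates from the degrees. -/

/-- The mixed radix number of `v`, whose digits are the indices `idx` of the first `k` vertices on
the way from `v` towards the root. -/
def radixCode (P : ℕ → ℕ) (par : V → V) (idx : V → ℕ) : ℕ → V → ℕ
  | 0, _ => 0
  | k + 1, v => radixCode P par idx k (par v) + P k * idx v

namespace Halves

variable {G : SimpleGraph V} {z : ℕ} {lev : V → ℕ} {par : V → V} {side : V → Bool}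

theorem neighborSet_eq (H : Halves G z lev par side) {p : V} (hp : lev p ≠ 0) :
    G.neighborSet p = insert (par p) {v | lev v ≠ 0 ∧ par v = p} := by
  ext v
  simp only [SimpleGraph.mem_neighborSet, Set.mem_insert_iff, Set.mem_ofPred_eq]
  constructor
  · intro hadj
    rcases H.adj_cases p v hadj with ⟨h1, h2⟩ | ⟨h1, h2⟩ | ⟨-, h1, -⟩
    · exact Or.inr ⟨h1, h2.symm⟩
    · exact Or.inl h2
    · exact absurd h1 hp
  · rintro (rfl | ⟨h1, rfl⟩)
    · exact H.adj_par p hp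
    · exact (H.adj_par v h1).symm

theorem ncard_children [Finite V] (H : Halves G z lev par side) {p : V} (hp : lev p ≠ 0) :
    (G.neighborSet p).ncard = {v | lev v ≠ 0 ∧ par v = p}.ncard + 1 := by
  rw [H.neighborSet_eq hp, Set.ncard_insert_of_notMem _ (Set.toFinite _)]
  rintro ⟨h1, h2⟩
  have h3 := H.lev_par _ h1
  have h4 := H.lev_par _ hp
  rw [h2] at h3
  omega

theorem side_par_of_two_le (H : Halves G z lev par side) {v : V} (hv : 2 ≤ lev v) :
    side (par v) = side v := by
  rcases H.side_par v (by omega) with h | h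
  · omega
  · exact h

theorem lev_le_dist (H : Halves G z lev par side) {c : V} (hc : lev c = 0) (v : V) :
    lev v ≤ G.dist c v := by
  have := H.sub_le_dist (fun v => (lev v : ℤ)) (fun v hv => by
    have := H.lev_par v hv
    rw [abs_le]; omega) (fun u v _ hu hv _ => by omega) c v
  omega

/-- Degree at least 3 leaves every vertex at levels `1, …, h - 1` a child, so each half reaches
level `h`. -/
theorem exists_lev_eq [Finite V] (H : Halves G z lev par side) {h : ℕ} {m : ℕ → ℕ}
    (hm : ∀ i, 1 ≤ i → i ≤ h - 1 → 3 ≤ m i)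
    (hdeg : ∀ v, lev v < h → (G.neighborSet v).ncard = m (lev v)) (s : Bool) {k : ℕ}
    (hk : 1 ≤ k) (hkh : k ≤ h) : ∃ v, lev v = k ∧ side v = s := by
  induction k, hk using Nat.le_induction with
  | base => exact H.one_exists s
  | succ k hk ih =>
    obtain ⟨p, hp, hs⟩ := ih (by omega)
    have h1 := hdeg p (by omega)
    rw [H.ncard_children (by omega), hp] at h1
    have h2 := hm k hk (by omega)
    obtain ⟨v, hv, rfl⟩ := Set.nonempty_of_ncard_ne_zero (s := {v | lev v ≠ 0 ∧ par v = p})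
      (by omega)
    have h3 := H.lev_par v hv
    exact ⟨v, by omega, by rw [← hs, H.side_par_of_two_le (by omega)]⟩

/-- The height bounds all levels, and the diameter is `2h` or `2h + 1` according to the number of
central vertices. -/
theorem lev_le_and_diam [Finite V] (H : Halves G z lev par side) {h : ℕ} {m : ℕ → ℕ} (hh : 1 ≤ h)
    (hm : ∀ i, 1 ≤ i → i ≤ h - 1 → 3 ≤ m i)
    (hdeg : ∀ v, lev v < h → (G.neighborSet v).ncard = m (lev v))
    (hcenter : ∀ v, v ∈ G.center → lev v = 0) (hcenter' : ∃ c, c ∈ G.center)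
    (hdiam : G.diam / 2 = h) : (∀ v, lev v ≤ h) ∧ G.diam + 1 = 2 * h + z := by
  have : Nonempty V := H.connected.nonempty
  have hdd : ∀ u v, G.dist u v ≤ G.diam := fun u v =>
    SimpleGraph.dist_le_diam (SimpleGraph.connected_iff_ediam_ne_top.1 H.connected)
  have hopp : ∀ s : Bool, ∃ w, lev w = h ∧ side w ≠ s := fun s => by
    obtain ⟨w, h1, h2⟩ := H.exists_lev_eq hm hdeg (!s) hh le_rfl
    exact ⟨w, h1, by rw [h2]; cases s <;> simp⟩
  have hfar : ∀ v, lev v ≠ 0 → lev v + h + (z - 1) ≤ G.diam := by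
    intro v hv
    obtain ⟨w, h1, h2⟩ := hopp (side v)
    have h3 := H.le_dist_of_side_ne hv h2
    have h4 := hdd w v
    omega
  obtain ⟨w, hw, -⟩ := hopp true
  have hw' := hfar w (by omega)
  rcases H.z_eq with rfl | rfl
  · have hle : ∀ v, lev v ≤ h := by
      intro v
      by_contra hv
      have h1 := hfar v (by omega)
      have hv1 : lev v = h + 1 := by omega
      obtain ⟨a, ha, has⟩ := H.one_exists (side v)
      -- A vertex at level `h + 1` would make the tree lopsided: since the diameter is at most `2 *
      -- h + 1`, the other half stops at level `h`, and the level-1 vertex `a` above `v` has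
      -- eccentricity no larger than the center, hence would be central itself.
      have hecc : ∀ y, G.dist a y ≤ h + 1 := by
        intro y
        have h2 := H.dist_le a y
        by_cases hy : lev y = 0
        · omega
        by_cases hs : side y = side v
        · have := H.dist_le_of_side_eq (u := a) (v := y) (by omega) hy (by rw [has, hs])
          have := hfar y hy
          omega
        · have h3 := H.le_dist_of_side_ne (x := y) (y := v) (by omega) hs
          have h4 := hdd y v
          omega
      obtain ⟨c, hc⟩ := hcenter'
      have hac : a ∈ G.center := by
        rw [mem_center_iff_forall_dist H.connected] at hc ⊢
        intro x k hk y
        have h3 := hc x k hk v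
        have h4 := H.lev_le_dist (hcenter c (by rwa [mem_center_iff_forall_dist H.connected])) v
        have h5 := hecc y
        omega
      have := hcenter a hac
      omega
    refine ⟨hle, ?_⟩
    obtain ⟨u, v, huv⟩ := G.exists_dist_eq_diam
    have h1 := H.dist_le u v
    have h2 := hle u
    have h3 := hle v
    omega
  · refine ⟨fun v => ?_, by omega⟩
    by_cases hv : lev v = 0
    · omega
    · have := hfar v hv
      omega

/-- The children of each vertex are numbered arbitrarily, and a vertex's own number becomes the most
significant digit of its code. Reducing modulo `P k` then removes exactly that digit and leaves the
parent's code. -/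
theorem exists_coord [Finite V] (H : Halves G z lev par side) {h : ℕ} {m : ℕ → ℕ} (hh : 1 ≤ h)
    (hm : ∀ i, 1 ≤ i → i ≤ h - 1 → 3 ≤ m i)
    (hdeg : ∀ v, lev v < h → (G.neighborSet v).ncard = m (lev v)) (hle : ∀ v, lev v ≤ h) :
    ∃ code, Coord G z h (fun k => ∏ j ∈ Finset.Icc 1 k, (m j - 1)) lev par side code := by
  set P : ℕ → ℕ := fun k => ∏ j ∈ Finset.Icc 1 k, (m j - 1) with hP
  have hP0 : P 0 = 1 := by simp [hP]
  have hPs : ∀ k, P (k + 1) = P k * (m (k + 1) - 1) := fun k => by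
    simp only [hP]
    rw [Finset.prod_Icc_succ_top (by omega)]
  have hPpos : ∀ k, k < h → 0 < P k := by
    intro k hk
    refine Finset.prod_pos fun j hj => ?_
    rw [Finset.mem_Icc] at hj
    have := hm j hj.1 (by omega)
    omega
  have hex : ∀ p, ∃ g : V → ℕ, lev p ≠ 0 → lev p < h →
      Set.BijOn g {v | lev v ≠ 0 ∧ par v = p} (Set.Iio (m (lev p) - 1)) := by
    intro p
    by_cases hp : lev p ≠ 0 ∧ lev p < h
    · obtain ⟨g, hg⟩ := (Set.toFinite {v | lev v ≠ 0 ∧ par v = p}).exists_bijOn_of_encard_eq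
        (t := Set.Iio (m (lev p) - 1)) (by
          have h1 := hdeg p hp.2
          rw [H.ncard_children hp.1] at h1
          rw [← (Set.toFinite _).cast_ncard_eq, ← (Set.finite_Iio _).cast_ncard_eq,
            ← h1, Nat.add_sub_cancel, Set.ncard_eq_toFinset_card' (Set.Iio _)]
          simp)
      exact ⟨g, fun _ _ => hg⟩
    · exact ⟨fun _ => 0, fun h1 h2 => absurd ⟨h1, h2⟩ hp⟩
  choose g hg using hex
  obtain ⟨code, hcode0, hcodes⟩ : ∃ code : V → ℕ, (∀ v, lev v = 1 → code v = 0) ∧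
      ∀ v k, lev v = k + 2 → code v = code (par v) + P k * g (par v) v := by
    refine ⟨fun v => radixCode P par (fun v => g (par v) v) (lev v - 1) v, ?_, ?_⟩
    · intro v hv
      simp [hv, radixCode]
    · intro v k hv
      have h1 := H.lev_par v (by omega)
      have h2 : lev (par v) - 1 = k := by omega
      have h3 : lev v - 1 = k + 1 := by omega
      simp only [h2, h3, radixCode]
  have hgv : ∀ v k, lev v = k + 2 → lev (par v) = k + 1 ∧
      Set.BijOn (g (par v)) {u | lev u ≠ 0 ∧ par u = par v} (Set.Iio (m (k + 1) - 1)) := by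
    intro v k hv
    have h1 := H.lev_par v (by omega)
    have h2 := hle v
    have h3 := hg (par v) (by omega) (by omega)
    rw [show lev (par v) = k + 1 by omega] at h3
    exact ⟨by omega, h3⟩
  have hlt : ∀ k v, lev v = k + 1 → code v < P k := by
    intro k
    induction k with
    | zero => intro v hv; rw [hcode0 v hv, hP0]; exact one_pos
    | succ k ih =>
      intro v hv
      obtain ⟨h1, h2⟩ := hgv v k hv
      have h3 := ih (par v) h1
      have h4 : g (par v) v < m (k + 1) - 1 := h2.mapsTo ⟨by omega, rfl⟩
      rw [hcodes v k hv, hPs]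
      calc _ < P k + P k * g (par v) v := by omega
        _ = P k * (g (par v) v + 1) := by ring
        _ ≤ _ := Nat.mul_le_mul_left _ h4
  have hpar : ∀ k v, lev v = k + 2 → code (par v) = code v % P k := by
    intro k v hv
    rw [hcodes v k hv, Nat.add_mul_mod_self_left, Nat.mod_eq_of_lt (hlt k _ (hgv v k hv).1)]
  refine ⟨code, { H with
    h_pos := hh
    P_zero := hP0
    P_succ := ?_
    lev_le := hle
    code_lt := ?_
    code_par := ?_
    code_inj := ?_
    code_surj := ?_ }⟩
  · intro i hi
    have := hm (i + 1) (by omega) (by omega)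
    exact ⟨m (i + 1) - 1, by omega, hPs i⟩
  · intro v hv
    exact hlt _ v (by omega)
  · intro v hv
    exact hpar _ v (by omega)
  · have key : ∀ k u v, lev u = k + 1 → lev v = k + 1 → side u = side v → code u = code v →
        u = v := by
      intro k
      induction k with
      | zero => intro u v hu hv hs _; exact H.one_unique u v hu hv hs
      | succ k ih =>
        intro u v hu hv hs hc
        obtain ⟨h1, h2⟩ := hgv u k hu
        obtain ⟨h3, h4⟩ := hgv v k hv
        have hpe : par u = par v := by
          refine ih _ _ h1 h3 ?_ ?_
          · rw [H.side_par_of_two_le (by omega), H.side_par_of_two_le (by omega), hs]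
          · rw [hpar k u hu, hpar k v hv, hc]
        have h5 := hle u
        rw [hcodes u k hu, hcodes v k hv, hpe] at hc
        have h6 := Nat.eq_of_mul_eq_mul_left (hPpos k (by omega)) (Nat.add_left_cancel hc)
        exact h4.injOn ⟨by omega, hpe⟩ ⟨by omega, rfl⟩ h6
    intro u v hu huv hs hc
    exact key (lev u - 1) u v (by omega) (by omega) hs hc
  · intro s k
    induction k with
    | zero =>
      intro t _ ht
      obtain ⟨v, hv, hs⟩ := H.one_exists s
      refine ⟨v, hv, hs, ?_⟩
      rw [hP0] at ht
      rw [hcode0 v hv]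
      omega
    | succ k ih =>
      intro t hk ht
      have hpos := hPpos k (by omega)
      obtain ⟨p, hp, hps, hpc⟩ := ih (t % P k) (by omega) (Nat.mod_lt _ hpos)
      have h1 := hg p (by omega) (by omega)
      rw [hp] at h1
      have h2 : t / P k < m (k + 1) - 1 := by
        rw [Nat.div_lt_iff_lt_mul hpos, mul_comm, ← hPs]
        exact ht
      obtain ⟨v, ⟨hv, rfl⟩, hgv'⟩ := h1.surjOn h2
      have h3 := H.lev_par v hv
      refine ⟨v, by omega, ?_, ?_⟩
      · rw [← H.side_par_of_two_le (by omega), hps]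
      · rw [hcodes v k (by omega), hpc, hgv', Nat.mod_add_div]

end Halves

/-! ### Splitting a tree at a central vertex or a central edge. -/

/-- A tree rooted at a vertex with exactly two neighbours consists of two halves. -/
theorem exists_halves_of_vertex {G : SimpleGraph V} (hG : G.IsTree) {c : V}
    (hc : (G.neighborSet c).ncard = 2) :
    ∃ par side, Halves G 1 (fun v => G.dist c v) par side := by
  classical
  obtain ⟨a, b, hab, hN⟩ := Set.ncard_eq_two.1 hc
  have hex : ∀ v, ∃ p, G.dist c v ≠ 0 → G.Adj v p ∧ G.dist c v = G.dist c p + 1 := by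
    intro v
    by_cases hv : G.dist c v = 0
    · exact ⟨v, fun h => absurd hv h⟩
    · obtain ⟨p, hp⟩ := exists_adj_closer hG.connected hv
      exact ⟨p, fun _ => hp⟩
  choose par hpar using hex
  have hzero : ∀ v, G.dist c v = 0 → c = v := fun v hv => hG.connected.dist_eq_zero_iff.1 hv
  have hone : ∀ v, G.dist c v = 1 ↔ v = a ∨ v = b := by
    intro v
    rw [SimpleGraph.dist_eq_one_iff_adj, ← SimpleGraph.mem_neighborSet, hN]
    simp
  have hiter : ∀ k v, G.dist c v = k + 1 → G.dist c (par^[k] v) = 1 := by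
    intro k
    induction k with
    | zero => intro v hv; exact hv
    | succ k ih =>
      intro v hv
      have := (hpar v (by omega)).2
      exact ih (par v) (by omega)
  -- The half is read off from the ancestor at level 1; at `c` itself the value is junk, which is
  -- harmless for `z = 1`.
  refine ⟨par, fun v => decide (par^[G.dist c v - 1] v = a), ?_⟩
  constructor
  · exact hG.connected
  · exact Or.inl rfl
  · exact fun v hv => (hpar v hv).1
  · exact fun v hv => (hpar v hv).2.symm
  · intro u v huv
    rcases hG.dist_eq_dist_add_one_of_adj c huv with h | h
    · right; left
      have h0 : G.dist c u ≠ 0 := by omega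
      exact ⟨h0, dist_closer_unique hG huv (hpar u h0).1 h (hpar u h0).2⟩
    · left
      have h0 : G.dist c v ≠ 0 := by omega
      exact ⟨h0, dist_closer_unique hG huv.symm (hpar v h0).1 h (hpar v h0).2⟩
  · intro v hv
    have h1 := (hpar v hv).2
    by_cases h2 : G.dist c v = 1
    · exact Or.inl ⟨h2, rfl⟩
    · right
      have h3 : G.dist c v - 1 = (G.dist c (par v) - 1) + 1 := by omega
      rw [h3, Function.iterate_succ_apply]
  · intro u v hu hv hs
    simp only [hu, hv, le_refl, tsub_eq_zero_of_le, Function.iterate_zero, id] at hs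
    rcases (hone u).1 hu with rfl | rfl <;> rcases (hone v).1 hv with rfl | rfl <;> simp_all
  · intro s
    cases s
    · refine ⟨b, (hone b).2 (Or.inr rfl), ?_⟩
      simp [(hone b).2 (Or.inr rfl), Ne.symm hab]
    · refine ⟨a, (hone a).2 (Or.inl rfl), ?_⟩
      simp [(hone a).2 (Or.inl rfl)]
  · intro u v hu hv _
    rw [← hzero u hu, ← hzero v hv]
  · exact fun _ => ⟨c, by simp, by simp⟩
  · intro u v hu hv
    rw [← hzero u hu, ← hzero v hv]
    simp

theorem exists_adj_closer_same_half {G : SimpleGraph V} (hG : G.IsTree) {c d v : V}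
    (hcd : G.Adj c d) (hv : G.dist d v = G.dist c v + 1) (h0 : G.dist c v ≠ 0) :
    ∃ p, G.Adj v p ∧ G.dist c v = G.dist c p + 1 ∧ G.dist d p = G.dist c p + 1 := by
  obtain ⟨p, hp, hpd⟩ := exists_adj_closer hG.connected h0
  refine ⟨p, hp, hpd, ?_⟩
  have h1 := hG.dist_eq_dist_add_one_of_adj d hp
  have h2 := hG.dist_eq_dist_add_one_of_adj p hcd
  rw [SimpleGraph.dist_comm, SimpleGraph.dist_comm (v := d)] at h2
  omega

/-- The edge `cd` is the only one joining the two halves: otherwise `u` would have two neighbours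
closer to `d`, namely `v` and its parent in the half of `c`. -/
theorem eq_of_adj_of_halves_ne {G : SimpleGraph V} (hG : G.IsTree) {c d u v : V}
    (hcd : G.Adj c d) (huv : G.Adj u v) (hu : G.dist d u = G.dist c u + 1)
    (hv : G.dist c v = G.dist d v + 1) : G.dist c u = 0 ∧ G.dist d v = 0 := by
  have h1 := hG.dist_eq_dist_add_one_of_adj c huv
  have h2 := hG.dist_eq_dist_add_one_of_adj d huv
  by_cases h0 : G.dist c u = 0
  · omega
  · obtain ⟨p, hp, hp1, hp2⟩ := exists_adj_closer_same_half hG hcd hu h0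
    obtain rfl := dist_closer_unique hG (x := d) hp huv (by omega) (by omega)
    omega

theorem exists_unique_other_neighbor {G : SimpleGraph V} {c d : V} (hcd : G.Adj c d)
    (hc : (G.neighborSet c).ncard = 2) :
    ∃ a, a ≠ d ∧ ∀ v, G.Adj c v ↔ v = a ∨ v = d := by
  obtain ⟨a, b, hab, hN⟩ := Set.ncard_eq_two.1 hc
  have key : ∀ v, G.Adj c v ↔ v = a ∨ v = b := fun v => by
    rw [← SimpleGraph.mem_neighborSet, hN]; simp
  rcases (key d).1 hcd with rfl | rfl
  · exact ⟨b, hab.symm, fun v => (key v).trans or_comm⟩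
  · exact ⟨a, hab, key⟩

/-- A tree is divided into two halves by an edge whose ends both have degree two. -/
theorem exists_halves_of_edge {G : SimpleGraph V} (hG : G.IsTree) {c d : V} (hcd : G.Adj c d)
    (hc : (G.neighborSet c).ncard = 2) (hd : (G.neighborSet d).ncard = 2) :
    ∃ par side, Halves G 2 (fun v => min (G.dist c v) (G.dist d v)) par side := by
  classical
  have hT : ∀ v, G.dist c v = G.dist d v + 1 ∨ G.dist d v = G.dist c v + 1 := by
    intro v
    have := hG.dist_eq_dist_add_one_of_adj v hcd
    rwa [SimpleGraph.dist_comm, SimpleGraph.dist_comm (v := d)] at this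
  have hex : ∀ v, ∃ p, min (G.dist c v) (G.dist d v) ≠ 0 → G.Adj v p ∧
      ((G.dist d v = G.dist c v + 1 ∧ G.dist c v = G.dist c p + 1 ∧
          G.dist d p = G.dist c p + 1) ∨
        (G.dist c v = G.dist d v + 1 ∧ G.dist d v = G.dist d p + 1 ∧
          G.dist c p = G.dist d p + 1)) := by
    intro v
    by_cases h0 : min (G.dist c v) (G.dist d v) = 0
    · exact ⟨v, fun h => absurd h0 h⟩
    · rcases hT v with h | h
      · obtain ⟨p, h1, h2⟩ := exists_adj_closer_same_half hG hcd.symm h (by omega)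
        exact ⟨p, fun _ => ⟨h1, Or.inr ⟨h, h2⟩⟩⟩
      · obtain ⟨p, h1, h2⟩ := exists_adj_closer_same_half hG hcd h (by omega)
        exact ⟨p, fun _ => ⟨h1, Or.inl ⟨h, h2⟩⟩⟩
  choose par hpar using hex
  have hzc : ∀ v, G.dist c v = 0 → c = v := fun v hv => hG.connected.dist_eq_zero_iff.1 hv
  have hzd : ∀ v, G.dist d v = 0 → d = v := fun v hv => hG.connected.dist_eq_zero_iff.1 hv
  have hdc : G.dist d c = 1 := SimpleGraph.dist_eq_one_iff_adj.2 hcd.symm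
  have hcd1 : G.dist c d = 1 := SimpleGraph.dist_eq_one_iff_adj.2 hcd
  obtain ⟨a, had, hca⟩ := exists_unique_other_neighbor hcd hc
  obtain ⟨b, hbc, hdb⟩ := exists_unique_other_neighbor hcd.symm hd
  have hone_c : ∀ v, G.dist c v = 1 → G.dist d v = 2 → v = a := by
    intro v h1 h2
    rw [SimpleGraph.dist_eq_one_iff_adj, hca] at h1
    rcases h1 with rfl | rfl
    · rfl
    · simp at h2
  have hone_d : ∀ v, G.dist d v = 1 → G.dist c v = 2 → v = b := by
    intro v h1 h2
    rw [SimpleGraph.dist_eq_one_iff_adj, hdb] at h1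
    rcases h1 with rfl | rfl
    · rfl
    · simp at h2
  have ha : G.dist c a = 1 ∧ G.dist d a = 2 := by
    have h1 : G.dist c a = 1 := by rw [SimpleGraph.dist_eq_one_iff_adj, hca]; exact Or.inl rfl
    have h2 : G.dist d a ≠ 0 := fun h => had (hzd a h).symm
    have := hT a
    omega
  have hb : G.dist d b = 1 ∧ G.dist c b = 2 := by
    have h1 : G.dist d b = 1 := by rw [SimpleGraph.dist_eq_one_iff_adj, hdb]; exact Or.inl rfl
    have h2 : G.dist c b ≠ 0 := fun h => hbc (hzc b h).symm
    have := hT b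
    omega
  refine ⟨par, fun v => decide (G.dist c v < G.dist d v), ?_⟩
  constructor
  · exact hG.connected
  · exact Or.inr rfl
  · exact fun v hv => (hpar v hv).1
  · intro v hv
    have := (hpar v hv).2
    omega
  · intro u v huv
    have hu := hT u
    have hv := hT v
    have h1 := hG.dist_eq_dist_add_one_of_adj c huv
    have h2 := hG.dist_eq_dist_add_one_of_adj d huv
    by_cases hs : (G.dist c u < G.dist d u ↔ G.dist c v < G.dist d v)
    · by_cases hlt : min (G.dist c u) (G.dist d u) < min (G.dist c v) (G.dist d v)
      · left
        have h0 : min (G.dist c v) (G.dist d v) ≠ 0 := by omega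
        refine ⟨h0, ?_⟩
        obtain ⟨h3, h4⟩ := hpar v h0
        rcases h4 with h4 | h4
        · exact dist_closer_unique hG (x := c) huv.symm h3 (by omega) (by omega)
        · exact dist_closer_unique hG (x := d) huv.symm h3 (by omega) (by omega)
      · right; left
        have h0 : min (G.dist c u) (G.dist d u) ≠ 0 := by omega
        refine ⟨h0, ?_⟩
        obtain ⟨h3, h4⟩ := hpar u h0
        rcases h4 with h4 | h4
        · exact dist_closer_unique hG (x := c) huv h3 (by omega) (by omega)
        · exact dist_closer_unique hG (x := d) huv h3 (by omega) (by omega)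
    · right; right
      have hz : (G.dist c u = 0 ∧ G.dist d v = 0) ∨ (G.dist c v = 0 ∧ G.dist d u = 0) := by
        by_cases hus : G.dist c u < G.dist d u
        · exact Or.inl (eq_of_adj_of_halves_ne hG hcd huv (by omega) (by omega))
        · exact Or.inr (eq_of_adj_of_halves_ne hG hcd huv.symm (by omega) (by omega))
      refine ⟨rfl, by omega, by omega, ?_⟩
      simpa [decide_eq_decide] using hs
  · intro v hv
    right
    have := (hpar v hv).2
    rw [decide_eq_decide]
    omega
  · intro u v hu hv hs
    rw [decide_eq_decide] at hs
    have h1 := hT u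
    have h2 := hT v
    by_cases h3 : G.dist c u < G.dist d u
    · rw [hone_c u (by omega) (by omega), hone_c v (by omega) (by omega)]
    · rw [hone_d u (by omega) (by omega), hone_d v (by omega) (by omega)]
  · intro s
    cases s
    · exact ⟨b, by omega, by simp; omega⟩
    · exact ⟨a, by omega, by simp; omega⟩
  · intro u v hu hv hs
    have hs := hs rfl
    rw [decide_eq_decide] at hs
    have h1 := hT u
    have h2 := hT v
    by_cases h3 : G.dist c u < G.dist d u
    · rw [← hzc u (by omega), ← hzc v (by omega)]
    · rw [← hzd u (by omega), ← hzd v (by omega)]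
  · intro s
    cases s
    · exact ⟨d, by simp, by simp⟩
    · exact ⟨c, by simp, by simp [hdc]⟩
  · intro u v hu hv
    have h1 := hT u
    have h2 := hT v
    have hu' : c = u ∨ d = u := by
      rcases h1 with h | h
      · exact Or.inr (hzd u (by omega))
      · exact Or.inl (hzc u (by omega))
    have hv' : c = v ∨ d = v := by
      rcases h2 with h | h
      · exact Or.inr (hzd v (by omega))
      · exact Or.inl (hzc v (by omega))
    rcases hu' with rfl | rfl <;> rcases hv' with rfl | rfl <;> simp [hdc, hcd1]

/-! ### Assembling the radio numbers. -/

theorem IsLevelwiseRegularTree.exists_coord_one [Fintype V] {G : SimpleGraph V} {h : ℕ}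
    {m : ℕ → ℕ} (hG : IsLevelwiseRegularTree G 1 h m) (hh : 1 ≤ h) (hm0 : m 0 = 2)
    (hm : ∀ i, 1 ≤ i → i ≤ h - 1 → 3 ≤ m i) :
    G.diam + 1 = 2 * h + 1 ∧ ∃ lev par side code,
      Coord G 1 h (fun k => ∏ j ∈ Finset.Icc 1 k, (m j - 1)) lev par side code := by
  obtain ⟨c, hc⟩ := Set.ncard_eq_one.1 hG.center_ncard
  have hlev : ∀ v, level G v = G.dist c v := by
    intro v
    unfold level
    rw [hc, Set.image_singleton, csInf_singleton, SimpleGraph.dist_comm]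
  have hdeg := hG.degree_eq
  simp only [hlev] at hdeg
  obtain ⟨par, side, H⟩ := exists_halves_of_vertex hG.isTree (c := c)
    (by rw [hdeg c (by simp; omega), SimpleGraph.dist_self, hm0])
  obtain ⟨hle, hdiam⟩ := H.lev_le_and_diam hh hm hdeg (by simp [hc]) ⟨c, by simp [hc]⟩
    hG.height_eq
  obtain ⟨code, C⟩ := H.exists_coord hh hm hdeg hle
  exact ⟨hdiam, _, _, _, _, C⟩

theorem IsLevelwiseRegularTree.exists_coord_two [Fintype V] {G : SimpleGraph V} {h : ℕ}
    {m : ℕ → ℕ} (hG : IsLevelwiseRegularTree G 2 h m) (hh : 1 ≤ h) (hm0 : m 0 = 2)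
    (hm : ∀ i, 1 ≤ i → i ≤ h - 1 → 3 ≤ m i) :
    G.diam + 1 = 2 * h + 2 ∧ ∃ lev par side code,
      Coord G 2 h (fun k => ∏ j ∈ Finset.Icc 1 k, (m j - 1)) lev par side code := by
  obtain ⟨c, d, hcd, hc⟩ := Set.ncard_eq_two.1 hG.center_ncard
  have hadj : G.Adj c d := center_adj hG.isTree (by simp [hc]) (by simp [hc]) hcd
  have hlev : ∀ v, level G v = min (G.dist c v) (G.dist d v) := by
    intro v
    unfold level
    rw [hc, Set.image_pair, csInf_pair, SimpleGraph.dist_comm, SimpleGraph.dist_comm (v := d)]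
  have hdeg := hG.degree_eq
  simp only [hlev] at hdeg
  obtain ⟨par, side, H⟩ := exists_halves_of_edge hG.isTree hadj
    (by rw [hdeg c (by simp; omega)]; simp [hm0]) (by rw [hdeg d (by simp; omega)]; simp [hm0])
  obtain ⟨hle, hdiam⟩ := H.lev_le_and_diam hh hm hdeg (by simp [hc]) ⟨c, by simp [hc]⟩
    hG.height_eq
  obtain ⟨code, C⟩ := H.exists_coord hh hm hdeg hle
  exact ⟨hdiam, _, _, _, _, C⟩

theorem radioNumber_eq_of_bounds [Fintype V] {G : SimpleGraph V} {D : ℕ} {B : ℤ}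
    (hD : G.diam + 1 = D)
    (hlow : ∀ f : V → ℕ, (∀ u v, u ≠ v → (D : ℤ) - G.dist u v ≤ |(f u : ℤ) - f v|) → B ≤ span f)
    (hup : ∃ f : V → ℕ, (∀ u v, u ≠ v → (D : ℤ) - G.dist u v ≤ |(f u : ℤ) - f v|) ∧
      (span f : ℤ) ≤ B) : (radioNumber G : ℤ) = B := by
  have hrad : ∀ f : V → ℕ, IsRadioLabelling G f ↔
      ∀ u v, u ≠ v → (D : ℤ) - G.dist u v ≤ |(f u : ℤ) - f v| := by
    intro f
    rw [← hD]
    push_cast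
    rfl
  obtain ⟨⟨f, hf, hfs⟩, hmin⟩ := radioNumber_isLeast G
  obtain ⟨f', hf', hs⟩ := hup
  have h1 := hlow f ((hrad f).1 hf)
  have h2 := hmin ⟨f', (hrad f').2 hf', rfl⟩
  rw [hfs] at h1
  have h3 : (radioNumber G : ℤ) ≤ span f' := by exact_mod_cast h2
  exact le_antisymm (h3.trans hs) h1

/-- The part of the span common to both bounds, summed level by level; the central vertices give `z
* (2 * h + 1)` and the two level-1 vertices give `4 * h - 2`. -/
theorem Coord.sum_weight [Fintype V] {G : SimpleGraph V} {z h : ℕ} {P : ℕ → ℕ} {lev : V → ℕ}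
    {par : V → V} {side : V → Bool} {code : V → ℕ} (C : Coord G z h P lev par side code) :
    ∑ v, (2 * (h : ℤ) + 1 - 2 * lev v) = z * (2 * h + 1) + (4 * h - 2) +
      ∑ i ∈ Finset.Icc 1 (h - 1), (4 * ((h : ℤ) - i) - 2) * P i := by
  have hh := C.h_pos
  rw [C.sum_lev (fun l => 2 * (h : ℤ) + 1 - 2 * l), Finset.range_eq_Ico,
    Finset.sum_eq_sum_Ico_succ_bot hh, C.P_zero, zero_add,
    show Finset.Icc 1 (h - 1) = Finset.Ico 1 h by ext; simp; omega,
    Finset.sum_congr rfl (g := fun i => (4 * ((h : ℤ) - i) - 2) * (P i : ℤ))]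
  · push_cast
    ring
  · intro i _
    push_cast
    ring

theorem cast_prod_pred {m : ℕ → ℕ} {k : ℕ} (hm : ∀ i, 1 ≤ i → i ≤ k → 1 ≤ m i) :
    ((∏ j ∈ Finset.Icc 1 k, (m j - 1) : ℕ) : ℤ) = ∏ j ∈ Finset.Icc 1 k, ((m j : ℤ) - 1) := by
  rw [Nat.cast_prod]
  refine Finset.prod_congr rfl fun j hj => ?_
  rw [Finset.mem_Icc] at hj
  have := hm j hj.1 hj.2
  push_cast [this]
  rfl

end RadioLabelling

theorem theorem4p1 {V : Type*} [Fintype V] (G : SimpleGraph V) (h : ℕ) (m : ℕ → ℕ)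
    (hh : 1 ≤ h) (hm0 : m 0 = 2) (hm : ∀ i : ℕ, 1 ≤ i → i ≤ h - 1 → 3 ≤ m i) :
    (RadioLabelling.IsLevelwiseRegularTree G 1 h m → 2 ≤ h →
      (RadioLabelling.radioNumber G : ℤ) =
        (∑ i ∈ Finset.Icc 1 (h - 1),
            (4 * ((h : ℤ) - (i : ℤ)) - 2) * (∏ j ∈ Finset.Icc 1 i, ((m j : ℤ) - 1)))
          + (∏ i ∈ Finset.Icc 1 (h - 1), ((m i : ℤ) - 1)) + 4 * (h : ℤ) - 1) ∧
    (RadioLabelling.IsLevelwiseRegularTree G 2 h m →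
      (RadioLabelling.radioNumber G : ℤ) =
        (∑ i ∈ Finset.Icc 1 (h - 1),
            (4 * ((h : ℤ) - (i : ℤ)) - 2) * (∏ j ∈ Finset.Icc 1 i, ((m j : ℤ) - 1)))
          + 2 * (∏ i ∈ Finset.Icc 1 (h - 1), ((m i : ℤ) - 1)) + 6 * (h : ℤ) - 3) := by
  have hcast : ∀ k, k ≤ h - 1 → ((∏ j ∈ Finset.Icc 1 k, (m j - 1) : ℕ) : ℤ) =
      ∏ j ∈ Finset.Icc 1 k, ((m j : ℤ) - 1) := fun k hk =>
    RadioLabelling.cast_prod_pred fun i h1 h2 => by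
      have := hm i h1 (by omega)
      omega
  have hsum : ∑ i ∈ Finset.Icc 1 (h - 1), (4 * ((h : ℤ) - (i : ℤ)) - 2) *
        ((∏ j ∈ Finset.Icc 1 i, (m j - 1) : ℕ) : ℤ) =
      ∑ i ∈ Finset.Icc 1 (h - 1),
        (4 * ((h : ℤ) - (i : ℤ)) - 2) * (∏ j ∈ Finset.Icc 1 i, ((m j : ℤ) - 1)) :=
    Finset.sum_congr rfl fun i hi => by rw [hcast i (Finset.mem_Icc.1 hi).2]
  constructor
  · intro hG h2
    obtain ⟨hdiam, lev, par, side, code, C⟩ := hG.exists_coord_one hh hm0 hm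
    have hS := C.sum_weight
    rw [hsum] at hS
    have hP := hcast (h - 1) le_rfl
    refine RadioLabelling.radioNumber_eq_of_bounds hdiam (fun f hf => ?_) ?_
    · have := C.le_span (Or.inr h2) (f := f) (by push_cast at hf ⊢; exact hf)
      rw [if_pos rfl, hS, hP] at this
      push_cast at this
      linarith
    · obtain ⟨f, hf, hs⟩ := C.exists_labelling_one
      refine ⟨f, by push_cast at hf ⊢; exact hf, ?_⟩
      rw [hS, hP] at hs
      push_cast at hs
      linarith
  · intro hG
    obtain ⟨hdiam, lev, par, side, code, C⟩ := hG.exists_coord_two hh hm0 hm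
    have hS := C.sum_weight
    rw [hsum] at hS
    have hP := hcast (h - 1) le_rfl
    refine RadioLabelling.radioNumber_eq_of_bounds hdiam (fun f hf => ?_) ?_
    · have := C.le_span (Or.inl rfl) (f := f) (by push_cast at hf ⊢; exact hf)
      rw [if_neg (by norm_num), hS, hP] at this
      push_cast at this
      linarith
    · obtain ⟨f, hf, hs⟩ := C.exists_labelling_two
      refine ⟨f, by push_cast at hf ⊢; exact hf, ?_⟩
      rw [hS, hP] at hs
      push_cast at hs
      linarith
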